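/- A proalgebraic group is an affine group scheme over $\mathbb{C}$; an algebraic group is an affine group scheme of finite type over $\mathbb{C}$. A morphism of proalgebraic groups is a quotient map if it is faithfully flat. For a set $X$ and a proalgebraic group $G$, a map $\varphi\colon X\to G(\mathbb{C})$ converges to $1$ if for every quotient map $f\colon G\to H$ onto an algebraic group $H$, one has $f_{\mathbb{C}}(\varphi(x))=1$ for all but finitely many $x\in X$. A free proalgebraic group on $X$ is a proalgebraic group $\Gamma(X)$ together with a map $\iota\colon X\to\Gamma(X)(\mathbb{C})$ converging to $1$ such that for every proalgebraic group $G$ and every map $\varphi\colon X\to G(\mathbb{C})$ converging to $1$ there is a unique morphism $f\colon\Gamma(X)\to G$ of proalgebraic groups with $f_{\mathbb{C}}\circ\iota=\varphi$. Lemma 3.1. Let $X$ be a set. For every finite subset $Y\subseteq X$ a free proalgebraic group on $Y$ exists. For each finite $Y\subseteq X$ let $\Gamma(Y)$, with the map $\iota^Y\colon Y\to\Gamma(Y)(\mathbb{C})$, be a free proalgebraic group on $Y$, and define $\iota_Y\colon X\to\Gamma(Y)(\mathbb{C})$ by $\iota_Y(x)=\iota^Y(x)$ if $x\in Y$ and $\iota_Y(x)=1$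 if $x\notin Y$. For finite subsets $Y\subseteq Y'$ of $X$ let $\varphi_{Y,Y'}\colon\Gamma(Y')\to\Gamma(Y)$ be the unique morphism that sends the generator $\iota^{Y'}(y')$ to $\iota_Y(y')$ for all $y'\in Y'$. The $\Gamma(Y)$ with these morphisms form a projective system of proalgebraic groups indexed by the finite subsets of $X$, directed by inclusion. Then $$\varprojlim_{Y}\Gamma(Y)=\Gamma(X).$$ Precisely, the projective limit $L$ of this system exists in the category of proalgebraic groups; there is a unique map $\iota\colon X\to L(\mathbb{C})$ whose composition with $L(\mathbb{C})\to\Gamma(Y)(\mathbb{C})$ is $\iota_Y$ for every finite $Y\subseteq X$; and $L$ together with $\iota$ is a free proalgebraic group on $X$. Conversely, if $(\Gamma,\iota)$ is a free proalgebraic group on $X$ with morphisms $\Gamma\to\Gamma(Y)$, one for each finite $Y\subseteq X$, that are compatible with the $\varphi_{Y,Y'}$ and send $\iota(x)$ to $\iota_Y(x)$ for all $x\in X$, then these morphisms make $\Gamma$ a projective limit of the system. -/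

import Mathlib

open CategoryTheory CategoryTheory.Limits AlgebraicGeometry MonoidalCategory

universe u

noncomputable section

/-- The base scheme `Spec ℂ` (in an arbitrary universe, so that schemes of arbitrary size over `ℂ`
are covered). -/
abbrev SpecComplex : Scheme.{u} := Spec (CommRingCat.of (ULift.{u} ℂ))

/-- Proalgebraic groups are affine group schemes over `ℂ`; their category is the full subcategory
of the category of group schemes over `ℂ` on the affine ones. -/
abbrev ProalgebraicGroup : Type (u + 1) :=
  ObjectProperty.FullSubcategory
    (fun G : Grp (Over SpecComplex.{u}) => IsAffine G.X.left)

namespace ProalgebraicGroup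

/-- The underlying morphism of schemes over `ℂ` of a morphism of proalgebraic groups. -/
abbrev Hom.toOver {G H : ProalgebraicGroup.{u}} (f : G ⟶ H) : G.obj.X ⟶ H.obj.X :=
  f.hom.hom.hom

/-- The group `G(ℂ)` of `ℂ`-points of a proalgebraic group `G`: morphisms `Spec ℂ ⟶ G` of
schemes over `ℂ`. -/
abbrev Points (G : ProalgebraicGroup.{u}) : Type u :=
  𝟙_ (Over SpecComplex.{u}) ⟶ G.obj.X

/-- The group structure on the set of `ℂ`-points coming from the group scheme. -/
instance (G : ProalgebraicGroup.{u}) : Group G.Points := Hom.group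

/-- The map `f_ℂ : G(ℂ) → H(ℂ)` induced on `ℂ`-points by a morphism of proalgebraic groups. -/
def mapPoints {G H : ProalgebraicGroup.{u}} (f : G ⟶ H) (p : G.Points) : H.Points :=
  p ≫ Hom.toOver f

/-- An algebraic group is an affine group scheme of finite type over `ℂ`. (An affine scheme over
`Spec ℂ` is quasi-compact, so locally of finite type is the same as of finite type.) -/
def IsAlgebraic (G : ProalgebraicGroup.{u}) : Prop :=
  LocallyOfFiniteType G.obj.X.hom

/-- A morphism of proalgebraic groups is a quotient map if it is faithfully flat, that is, flat and
surjective. -/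
def IsQuotientMap {G H : ProalgebraicGroup.{u}} (f : G ⟶ H) : Prop :=
  Flat (Hom.toOver f).left ∧ Surjective (Hom.toOver f).left

/-- A map `φ : X → G(ℂ)` converges to `1` if for every quotient map `f` from `G` to an algebraic
group `H`, all but finitely many elements of `X` map to `1` in `H(ℂ)`. -/
def ConvergesToOne {X : Type u} {G : ProalgebraicGroup.{u}} (φ : X → G.Points) : Prop :=
  ∀ (H : ProalgebraicGroup.{u}) (f : G ⟶ H), H.IsAlgebraic → IsQuotientMap f →
    {x : X | mapPoints f (φ x) ≠ 1}.Finite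

/-- The proalgebraic group `G` together with `ι : X → G(ℂ)` is a free proalgebraic group on `X`. -/
structure IsFreeOn {X : Type u} {G : ProalgebraicGroup.{u}} (ι : X → G.Points) : Prop where
  convergesToOne : ConvergesToOne ι
  existsUnique_hom : ∀ (H : ProalgebraicGroup.{u}) (φ : X → H.Points), ConvergesToOne φ →
    ∃! f : G ⟶ H, ∀ x, mapPoints f (ι x) = φ x

theorem mapPoints_id {G : ProalgebraicGroup.{u}} (p : G.Points) : mapPoints (𝟙 G) p = p :=
  Category.comp_id p

theorem mapPoints_comp {G H K : ProalgebraicGroup.{u}} (f : G ⟶ H) (g : H ⟶ K) (p : G.Points) :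
    mapPoints (f ≫ g) p = mapPoints g (mapPoints f p) :=
  (Category.assoc p (Hom.toOver f) (Hom.toOver g)).symm

theorem mapPoints_mul {G H : ProalgebraicGroup.{u}} (f : G ⟶ H) (p q : G.Points) :
    mapPoints f (p * q) = mapPoints f p * mapPoints f q :=
  MonObj.mul_comp p q (Hom.toOver f)

theorem mapPoints_one {G H : ProalgebraicGroup.{u}} (f : G ⟶ H) :
    mapPoints f (1 : G.Points) = 1 :=
  MonObj.one_comp (Hom.toOver f)

theorem convergesToOne_of_finite {X : Type u} [Finite X] {G : ProalgebraicGroup.{u}}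
    (φ : X → G.Points) : ConvergesToOne φ :=
  fun _ _ _ _ => Set.toFinite _

/-- The morphism out of a free proalgebraic group given by its universal property. -/
def IsFreeOn.lift {X : Type u} {G : ProalgebraicGroup.{u}} {ι : X → G.Points}
    (h : IsFreeOn ι) {H : ProalgebraicGroup.{u}} (φ : X → H.Points) (hφ : ConvergesToOne φ) :
    G ⟶ H :=
  (h.existsUnique_hom H φ hφ).choose

theorem IsFreeOn.lift_spec {X : Type u} {G : ProalgebraicGroup.{u}} {ι : X → G.Points}
    (h : IsFreeOn ι) {H : ProalgebraicGroup.{u}} (φ : X → H.Points) (hφ : ConvergesToOne φ)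
    (x : X) : mapPoints (h.lift φ hφ) (ι x) = φ x :=
  (h.existsUnique_hom H φ hφ).choose_spec.1 x

open Classical in
/-- For a finite subset `Y` of `X` and a map `ι : Y → G(ℂ)`, the map `X → G(ℂ)` which agrees with
`ι` on `Y` and sends every element outside `Y` to `1`. -/
def extendByOne {X : Type u} {G : ProalgebraicGroup.{u}} (Y : Finset X) (ι : Y → G.Points)
    (x : X) : G.Points :=
  if h : x ∈ Y then ι ⟨x, h⟩ else 1

section System

variable {X : Type u} (Γ : Finset X → ProalgebraicGroup.{u})
  (ι : ∀ Y : Finset X, Y → (Γ Y).Points) (hfree : ∀ Y : Finset X, IsFreeOn (ι Y))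

/-- The transition morphism `Γ(Y') ⟶ Γ(Y)` for arbitrary finite subsets `Y, Y'`: it sends a
generator `y' ∈ Y'` to `y'` if `y' ∈ Y` and to `1` otherwise. -/
def transition (Y Y' : Finset X) : Γ Y' ⟶ Γ Y :=
  (hfree Y').lift (fun y' : Y' => extendByOne Y (ι Y) y'.1) (convergesToOne_of_finite _)

theorem mapPoints_transition (Y Y' : Finset X) (y' : Y') :
    mapPoints (transition Γ ι hfree Y Y') (ι Y' y') = extendByOne Y (ι Y) y'.1 :=
  (hfree Y').lift_spec _ _ y'

/-- The projective system of the free proalgebraic groups `Γ(Y)` on the finite subsets `Y` of `X`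
(directed by inclusion) with the transition morphisms `Γ(Y') ⟶ Γ(Y)` for `Y ⊆ Y'`. -/
def freeSystem : (Finset X)ᵒᵖ ⥤ ProalgebraicGroup.{u} where
  obj Y := Γ Y.unop
  map {Y' Y} _ := transition Γ ι hfree Y.unop Y'.unop
  map_id Y := by
    refine ((hfree Y.unop).existsUnique_hom _ _ (convergesToOne_of_finite _)).unique
      (fun y => mapPoints_transition Γ ι hfree _ _ y) (fun y => ?_)
    rw [mapPoints_id, extendByOne, dif_pos y.2]
  map_comp {Y₁ Y₂ Y₃} f g := by
    refine ((hfree Y₁.unop).existsUnique_hom _ _ (convergesToOne_of_finite _)).unique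
      (fun y => mapPoints_transition Γ ι hfree _ _ y) (fun y => ?_)
    rw [mapPoints_comp, mapPoints_transition]
    by_cases h2 : y.1 ∈ Y₂.unop
    · rw [extendByOne, dif_pos h2, mapPoints_transition]
    · have h3 : y.1 ∉ Y₃.unop := fun h3 => h2 (leOfHom g.unop h3)
      rw [extendByOne, dif_neg h2, mapPoints_one, extendByOne, dif_neg h3]

/-- For a cone over the projective system (with apex `L`), a map `j : X → L(ℂ)` is canonical if its
component `X → Γ(Y)(ℂ)` sends `x` to the generator `x` if `x ∈ Y` and to `1` otherwise, for every
finite subset `Y` of `X`. -/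
def IsCanonicalMap (c : Cone (freeSystem Γ ι hfree)) (j : X → c.pt.Points) : Prop :=
  ∀ (Y : Finset X) (x : X),
    mapPoints (H := Γ Y) (c.π.app (Opposite.op Y)) (j x) = extendByOne Y (ι Y) x

end System

end ProalgebraicGroup

end

/-! Under the anti-equivalence between proalgebraic groups and commutative Hopf algebras, `ℂ`-points
become characters under convolution. A free group on any set `X` is written down explicitly: its
Hopf algebra `coefficientAlgebra` is generated by the matrix coefficients of those finite
dimensional representations of the abstract free group on `X` in which almost all generators act
trivially. The generator `x` is evaluation at the word `x`.

Existence in the universal property: a family of characters of `A` indexed by `X` extends to a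
homomorphism from the free group to the character group. Each `a` in `A` lies in a finite
dimensional comodule, so `w ↦ χ_w(a)` is a combination of matrix coefficients, provided `χ_x(a) =
ε(a)` for almost all `x`. Uniqueness holds because a morphism into an algebra of functions is a
homomorphism from the free group to characters, hence determined by the generators.

Convergence to `1` is tested only on faithfully flat maps, so the proviso requires finitely
generated Hopf subalgebras `B` of `A` to be faithfully flat under `A`
(`faithfullyFlat_of_injective`). This is proved by translation: finitely generated `B`-submodules of
`A` that are subcomodules have the same fibre dimension at every rational point, and a determinant
argument then gives relations near each point without assuming that `B` is reduced.

For the limit, killing the generators outside a finite `Y` is an idempotent endomorphism of the free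
group on `X` that factors through the retract `Γ(Y)`. Every function in the coefficient algebra
depends on finitely many generators, so it is fixed by these endomorphisms for large `Y`; compatible
maps therefore glue uniquely (`existsUnique_comp_of_eventually_eq`). The free group on `X` is thus a
limit, and both directions of the theorem follow from uniqueness of limits and of free objects. -/

noncomputable section

namespace ProalgebraicGroup

open MonObj CartesianMonoidalCategory Opposite TensorProduct WithConv
open scoped Obj

/-! ### Affine group schemes and commutative Hopf algebras -/

section General

variable (R : CommRingCat.{u})

/-- Characters of a commutative Hopf algebra are the morphisms from the unit in the
opposite category of algebras, compatibly with the group structures. -/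
def charMulEquivHom (A : Type u) [CommRing A] [HopfAlgebra R A] :
    WithConv (A →ₐ[R] R) ≃*
      (op (CommAlgCat.of R R) ⟶ op (CommAlgCat.of R A)) where
  toFun χ := (CommAlgCat.ofHom χ.ofConv).op
  invFun f := toConv f.unop.hom
  left_inv _ := rfl
  right_inv _ := rfl
  map_mul' f g := by
    apply Quiver.Hom.unop_inj
    apply CommAlgCat.hom_ext
    rw [Hom.mul_def, unop_comp, CommAlgCat.hom_comp, CommAlgCat.lift_unop_hom,
      CommAlgCat.mul_op_of_unop_hom, Quiver.Hom.unop_op]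
    exact AlgHom.ext (AlgHom.convMul_apply f g)

/-- The sections of the spectrum of a Hopf algebra are its characters. -/
def sectionsEquiv (A : Type u) [CommRing A] [HopfAlgebra R A] :
    WithConv (A →ₐ[R] R) ≃*
      (𝟙_ (Over (Spec R)) ⟶ ((hopfSpec R).obj (op (CommHopfAlgCat.of R A))).X) :=
  ((charMulEquivHom R A).trans
    (algSpec.fullyFaithful (R := R)).homMulEquiv).trans
  -- `algSpec` sends the unit only to an isomorphic copy of the unit; `ε` and its inverse `η`
  -- correct for this.
  { toFun := fun f => Functor.LaxMonoidal.ε (algSpec R) ≫ f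
    invFun := fun f => Functor.OplaxMonoidal.η (algSpec R) ≫ f
    left_inv := fun f => Functor.Monoidal.η_ε_assoc (algSpec R) f
    right_inv := fun f => Functor.Monoidal.ε_η_assoc (algSpec R) f
    map_mul' := fun f g => MonObj.comp_mul _ f g }


variable {R}
variable {A B : Type u} [CommRing A] [HopfAlgebra R A] [CommRing B] [HopfAlgebra R B]

theorem ε_algSpec_comp_map (f : B →ₐ[R] A) (χ : A →ₐ[R] R) :
    (Functor.LaxMonoidal.ε (algSpec R) ≫ (algSpec R).map (CommAlgCat.ofHom χ).op) ≫
      (algSpec R).map (CommAlgCat.ofHom f).op =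
      Functor.LaxMonoidal.ε (algSpec R) ≫ (algSpec R).map (CommAlgCat.ofHom (χ.comp f)).op := by
  rw [Category.assoc]
  refine congrArg (fun k => Functor.LaxMonoidal.ε (algSpec R) ≫ k) ?_
  exact ((algSpec R).map_comp _ _).symm

theorem sectionsEquiv_comp (f : B →ₐc[R] A) (χ : WithConv (A →ₐ[R] R)) :
    sectionsEquiv R A χ ≫ ((hopfSpec R).map (CommHopfAlgCat.ofHom f).op).hom.hom =
      sectionsEquiv R B (toConv (χ.ofConv.comp (f : B →ₐ[R] A))) :=
  ε_algSpec_comp_map _ _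

theorem hopfSpec_map_surjective : Function.Surjective
    (fun f : B →ₐc[R] A => (hopfSpec R).map (CommHopfAlgCat.ofHom f).op) := by
  intro f
  obtain ⟨g, hg⟩ := (hopfSpec R).map_surjective f
  exact ⟨g.unop.hom, hg⟩

theorem hopfSpec_map_injective : Function.Injective
    (fun f : B →ₐc[R] A => (hopfSpec R).map (CommHopfAlgCat.ofHom f).op) := by
  intro f g h
  have h1 := (hopfSpec R).map_injective h
  exact congrArg (fun k => (k.unop).hom) h1

theorem exists_iso_hopfSpec (G : Grp (Over (Spec R))) (hG : IsAffine G.X.left) :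
    ∃ (A : Type u) (_ : CommRing A) (_ : HopfAlgebra R A),
      Nonempty ((hopfSpec R).obj (op (CommHopfAlgCat.of R A)) ≅ G) := by
  obtain ⟨A, ⟨e⟩⟩ := essImage_hopfSpec.mpr hG
  exact ⟨A.unop, inferInstance, inferInstance, ⟨e⟩⟩

theorem isAffine_hopfSpec_obj : IsAffine ((hopfSpec R).obj (op (CommHopfAlgCat.of R A))).X.left :=
  essImage_hopfSpec.mp ⟨_, ⟨Iso.refl _⟩⟩

theorem locallyOfFiniteType_Spec_algebraMap_iff (R A : Type u) [CommRing R] [CommRing A]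
    [Algebra R A] : LocallyOfFiniteType (Spec.map (CommRingCat.ofHom (algebraMap R A))) ↔
      Algebra.FiniteType R A := by
  rw [HasRingHomProperty.Spec_iff (P := @LocallyOfFiniteType)]
  exact RingHom.finiteType_algebraMap

theorem flat_and_surjective_Spec_map {A B : Type u} [CommRing A] [CommRing B]
    (f : B →+* A) (hf : f.FaithfullyFlat) :
    Flat (Spec.map (CommRingCat.ofHom f)) ∧ Surjective (Spec.map (CommRingCat.ofHom f)) := by
  constructor
  · rw [HasRingHomProperty.Spec_iff (P := @Flat)]
    exact hf.flat
  · refine ⟨?_⟩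
    algebraize [f]
    exact PrimeSpectrum.comap_surjective_of_faithfullyFlat (A := B) (B := A)

end General

/-! ### The dictionary over the complex numbers -/

/-- The field of complex numbers, lifted to the universe `u`. -/
abbrev LiftedComplex : Type u := ULift.{u} ℂ

local notation "𝕂" => LiftedComplex

instance : IsAlgClosed LiftedComplex.{u} :=
  IsAlgClosed.of_exists_root _ fun p _ hp => by
    obtain ⟨z, hz⟩ := IsAlgClosed.exists_root (p.map (ULift.ringEquiv : 𝕂 ≃+* ℂ).toRingHom)
      (by rw [Polynomial.degree_map]; exact (Polynomial.degree_pos_of_irreducible hp).ne')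
    refine ⟨ULift.up z, (ULift.ringEquiv : 𝕂 ≃+* ℂ).injective ?_⟩
    rw [map_zero, ← hz, Polynomial.eval_map]
    exact (Polynomial.eval₂_at_apply (ULift.ringEquiv : 𝕂 ≃+* ℂ).toRingHom (ULift.up z)).symm

/-- The proalgebraic group attached to a commutative Hopf algebra. -/
def specGroup (A : Type u) [CommRing A] [HopfAlgebra 𝕂 A] : ProalgebraicGroup.{u} :=
  ⟨(hopfSpec (CommRingCat.of 𝕂)).obj (op (CommHopfAlgCat.of 𝕂 A)), isAffine_hopfSpec_obj⟩

variable {A B C : Type u} [CommRing A] [HopfAlgebra 𝕂 A] [CommRing B] [HopfAlgebra 𝕂 B]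
  [CommRing C] [HopfAlgebra 𝕂 C]

/-- The morphism of proalgebraic groups attached to a morphism of Hopf algebras. -/
def specMap (f : B →ₐc[𝕂] A) : specGroup A ⟶ specGroup B :=
  ObjectProperty.homMk ((hopfSpec (CommRingCat.of 𝕂)).map (CommHopfAlgCat.ofHom f).op)

variable (A) in
/-- The `ℂ`-points of the spectrum of a Hopf algebra are its characters. -/
def pointsEquiv : WithConv (A →ₐ[𝕂] 𝕂) ≃* (specGroup A).Points :=
  sectionsEquiv (CommRingCat.of 𝕂) A

theorem exists_specMap_eq (f : specGroup A ⟶ specGroup B) : ∃ g : B →ₐc[𝕂] A, specMap g = f := by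
  obtain ⟨g, hg⟩ := hopfSpec_map_surjective (R := CommRingCat.of 𝕂) (A := A) (B := B) f.hom
  exact ⟨g, ObjectProperty.hom_ext _ hg⟩

theorem specMap_injective :
    Function.Injective (specMap : (B →ₐc[𝕂] A) → (specGroup A ⟶ specGroup B)) :=
  fun _ _ h => hopfSpec_map_injective (R := CommRingCat.of 𝕂) (A := A) (B := B)
    (congrArg (fun k => k.hom) h)

theorem specMap_comp (f : B →ₐc[𝕂] A) (g : C →ₐc[𝕂] B) :
    specMap (f.comp g) = specMap f ≫ specMap g := by
  apply ObjectProperty.hom_ext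
  exact (hopfSpec (CommRingCat.of 𝕂)).map_comp (CommHopfAlgCat.ofHom f).op
    (CommHopfAlgCat.ofHom g).op

theorem mapPoints_specMap (f : B →ₐc[𝕂] A) (χ : WithConv (A →ₐ[𝕂] 𝕂)) :
    mapPoints (specMap f) (pointsEquiv A χ) =
      pointsEquiv B (toConv (χ.ofConv.comp (f : B →ₐ[𝕂] A))) :=
  sectionsEquiv_comp (R := CommRingCat.of 𝕂) f χ

theorem exists_iso_specGroup (G : ProalgebraicGroup.{u}) :
    ∃ (A : Type u) (_ : CommRing A) (_ : HopfAlgebra 𝕂 A), Nonempty (specGroup A ≅ G) := by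
  obtain ⟨A, _, _, ⟨e⟩⟩ := exists_iso_hopfSpec (R := CommRingCat.of 𝕂) G.obj G.property
  exact ⟨A, inferInstance, inferInstance, ⟨ObjectProperty.isoMk (X := specGroup A) (Y := G) _ e⟩⟩

theorem isAlgebraic_specGroup_iff : (specGroup A).IsAlgebraic ↔ Algebra.FiniteType 𝕂 A :=
  locallyOfFiniteType_Spec_algebraMap_iff 𝕂 A

theorem isQuotientMap_specMap (f : B →ₐc[𝕂] A)
    (hf : (f : B →ₐ[𝕂] A).toRingHom.FaithfullyFlat) : IsQuotientMap (specMap f) :=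
  flat_and_surjective_Spec_map _ hf

end ProalgebraicGroup

/-! ### Local finiteness: comodules and finitely generated Hopf subalgebras -/

namespace HopfAlgebra

open TensorProduct Coalgebra

variable {k A : Type*} [Field k] [CommRing A]

section Coalgebra

variable [HopfAlgebra k A]

variable (A) in
/-- Contraction of the left tensor factor with a linear functional. -/
def contractLeft (φ : A →ₗ[k] k) : A ⊗[k] A →ₗ[k] A :=
  (TensorProduct.lid k A).toLinearMap ∘ₗ φ.rTensor A

variable (A) in
/-- Contraction of the right tensor factor with a linear functional. -/
def contractRight (φ : A →ₗ[k] k) : A ⊗[k] A →ₗ[k] A :=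
  (TensorProduct.rid k A).toLinearMap ∘ₗ φ.lTensor A

@[simp]
theorem contractLeft_tmul (φ : A →ₗ[k] k) (a b : A) :
    contractLeft A φ (a ⊗ₜ b) = φ a • b := by
  simp [contractLeft]

@[simp]
theorem contractRight_tmul (φ : A →ₗ[k] k) (a b : A) :
    contractRight A φ (a ⊗ₜ b) = φ b • a := by
  simp [contractRight]

theorem contractLeft_counit (x : A) : contractLeft A (counit (R := k)) (comul x) = x := by
  simp [contractLeft]

theorem contractRight_counit (x : A) : contractRight A (counit (R := k)) (comul x) = x := by
  simp [contractRight]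

theorem counit_contractLeft_comul (φ : A →ₗ[k] k) (x : A) :
    counit (R := k) (contractLeft A φ (comul x)) = φ x := by
  have h : counit (R := k) ∘ₗ contractLeft A φ = φ ∘ₗ contractRight A (counit (R := k)) := by
    ext a b
    simp [mul_comm]
  have := LinearMap.congr_fun h (comul x)
  rwa [LinearMap.comp_apply, LinearMap.comp_apply, contractRight_counit] at this

/-- Coassociativity: contracting the last leg of the iterated comultiplication does not touch the
first two. -/
theorem comul_contractRight (φ : A →ₗ[k] k) (x : A) :
    comul (R := k) (contractRight A φ (comul x)) =
      (contractRight A φ ∘ₗ comul).lTensor A (comul x) := by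
  have h1 : comul (R := k) ∘ₗ contractRight A φ =
      (TensorProduct.rid k _).toLinearMap ∘ₗ φ.lTensor (A ⊗[k] A) ∘ₗ
        (comul (R := k)).rTensor A := by
    ext a b; simp
  have h2 : ((TensorProduct.rid k _).toLinearMap ∘ₗ φ.lTensor (A ⊗[k] A)) ∘ₗ
      (TensorProduct.assoc k A A A).symm.toLinearMap = (contractRight A φ).lTensor A := by
    ext a b c; simp
  have h3 := LinearMap.congr_fun h1 (comul x)
  simp only [LinearMap.comp_apply] at h3
  rw [h3, ← coassoc_symm_apply, LinearMap.lTensor_comp, LinearMap.comp_apply, ← h2]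
  rfl

theorem comul_contractLeft (φ : A →ₗ[k] k) (x : A) :
    comul (R := k) (contractLeft A φ (comul x)) =
      (contractLeft A φ ∘ₗ comul).rTensor A (comul x) := by
  have h1 : comul (R := k) ∘ₗ contractLeft A φ =
      (TensorProduct.lid k _).toLinearMap ∘ₗ φ.rTensor (A ⊗[k] A) ∘ₗ
        (comul (R := k)).lTensor A := by
    ext a b; simp
  have h2 : ((TensorProduct.lid k _).toLinearMap ∘ₗ φ.rTensor (A ⊗[k] A)) ∘ₗ
      (TensorProduct.assoc k A A A).toLinearMap = (contractLeft A φ).rTensor A := by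
    ext a b c; simp [TensorProduct.smul_tmul']
  have h3 := LinearMap.congr_fun h1 (comul x)
  simp only [LinearMap.comp_apply] at h3
  rw [h3, ← coassoc_apply, LinearMap.rTensor_comp, LinearMap.comp_apply, ← h2]
  rfl

/-- The image of `V ⊗ A` in `A ⊗ A`. -/
def leftTensor (V : Submodule k A) : Submodule k (A ⊗[k] A) :=
  Submodule.map₂ (TensorProduct.mk k A A) V ⊤

theorem tmul_mem_leftTensor {V : Submodule k A} {v : A} (hv : v ∈ V) (a : A) :
    v ⊗ₜ a ∈ leftTensor V :=
  Submodule.apply_mem_map₂ (TensorProduct.mk k A A) hv Submodule.mem_top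

theorem leftTensor_mono {V W : Submodule k A} (h : V ≤ W) : leftTensor V ≤ leftTensor W :=
  Submodule.map₂_le_map₂_left h

theorem leftTensor_induction {V : Submodule k A} {p : A ⊗[k] A → Prop}
    (tmul : ∀ v ∈ V, ∀ a, p (v ⊗ₜ a)) (zero : p 0) (add : ∀ s t, p s → p t → p (s + t))
    {t : A ⊗[k] A} (ht : t ∈ leftTensor V) : p t := by
  rw [leftTensor, Submodule.map₂_eq_span_image2] at ht
  induction ht using Submodule.closure_induction with
  | zero => exact zero
  | add s t _ _ hs ht => exact add s t hs ht
  | smul_mem c t ht =>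
    obtain ⟨v, hv, a, -, rfl⟩ := ht
    exact tmul _ (V.smul_mem c hv) a

/-- Every element of a Hopf algebra lies in a finite dimensional right subcomodule. -/
theorem exists_fg_subcomodule (x : A) : ∃ V : Submodule k A, V.FG ∧ x ∈ V ∧
    ∀ v ∈ V, comul v ∈ leftTensor V := by
  classical
  let e := Module.Basis.ofVectorSpace k A
  -- Write `Δ x = ∑ c i ⊗ e i` in a basis of the second factor. The finitely many nonzero `c i` span
  -- the subcomodule, since each is a contraction of `Δ x`.
  let c := TensorProduct.equivFinsuppOfBasisRight e (comul (R := k) x)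
  have hc : comul x = c.sum fun i m => m ⊗ₜ[k] e i := by
    rw [← TensorProduct.equivFinsuppOfBasisRight_symm_apply, LinearEquiv.symm_apply_apply]
  have hci (i) : c i = contractRight A (e.coord i) (comul x) :=
    TensorProduct.equivFinsuppOfBasisRight_apply ..
  have hmem (i) : c i ∈ Submodule.span k (Set.range c) := Submodule.subset_span ⟨i, rfl⟩
  refine ⟨Submodule.span k (Set.range c), ?_, ?_, ?_⟩
  · exact ⟨(c.finite_range).toFinset, by simp⟩
  · rw [← contractRight_counit (k := k) x, hc, Finsupp.sum, map_sum]
    refine Submodule.sum_mem _ fun i _ => ?_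
    rw [contractRight_tmul]
    exact Submodule.smul_mem _ _ (hmem i)
  · intro v hv
    induction hv using Submodule.span_induction with
    | zero => rw [map_zero]; exact zero_mem _
    | add v w _ _ hv hw => rw [map_add]; exact add_mem hv hw
    | smul a v _ hv => rw [map_smul]; exact Submodule.smul_mem _ _ hv
    | mem v hv =>
      obtain ⟨i, rfl⟩ := hv
      rw [hci, comul_contractRight, hc, Finsupp.sum, map_sum]
      refine Submodule.sum_mem _ fun j _ => ?_
      rw [LinearMap.lTensor_tmul]
      exact tmul_mem_leftTensor (hmem j) _

/-- Every finite subset of a Hopf algebra lies in a finite dimensional right subcomodule. -/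
theorem exists_fg_subcomodule_of_finite {s : Set A} (hs : s.Finite) :
    ∃ V : Submodule k A, V.FG ∧ s ⊆ V ∧ ∀ v ∈ V, comul v ∈ leftTensor V := by
  induction s, hs using Set.Finite.induction_on with
  | empty => 
    refine ⟨⊥, Submodule.fg_bot, Set.empty_subset _, fun v hv => ?_⟩
    rw [(Submodule.mem_bot k).mp hv, map_zero]
    exact zero_mem _
  | @insert a s _ _ ih =>
    obtain ⟨V, hV, hsV, hV'⟩ := ih
    obtain ⟨W, hW, haW, hW'⟩ := exists_fg_subcomodule (k := k) a
    refine ⟨V ⊔ W, hV.sup hW, ?_, fun v hv => ?_⟩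
    · rintro b (rfl | hb)
      · exact (le_sup_right : W ≤ V ⊔ W) haW
      · exact (le_sup_left : V ≤ V ⊔ W) (hsV hb)
    · obtain ⟨y, hy, z, hz, rfl⟩ := Submodule.mem_sup.mp hv
      rw [map_add]
      exact add_mem (leftTensor_mono le_sup_left (hV' y hy))
        (leftTensor_mono le_sup_right (hW' z hz))

/-- A finite dimensional right subcomodule is described by a multiplicative matrix. -/
theorem exists_comatrix (x : A) : ∃ (n : ℕ) (b : Fin n → A) (M : Matrix (Fin n) (Fin n) A),
    x ∈ Submodule.span k (Set.range b) ∧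
    (∀ i, comul (R := k) (b i) = ∑ j, b j ⊗ₜ M j i) ∧
    (∀ l i, comul (R := k) (M l i) = ∑ j, M l j ⊗ₜ M j i) ∧
    ∀ l i, counit (R := k) (M l i) = if l = i then 1 else 0 := by
  classical
  obtain ⟨V, hV, hxV, hV'⟩ := exists_fg_subcomodule (k := k) x
  have : Module.Finite k V := Module.Finite.iff_fg.mpr hV
  let b := Module.finBasis k V
  have hspan : Submodule.span k (Set.range fun i => (b i : A)) = V := by
    rw [show (fun i => (b i : A)) = V.subtype ∘ b from rfl, Set.range_comp,
      Submodule.span_image, b.span_eq, Submodule.map_top, Submodule.range_subtype]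
  have hex (t : A ⊗[k] A) (ht : t ∈ leftTensor V) :
      ∃ c : Fin (Module.finrank k V) → A, t = ∑ j, (b j : A) ⊗ₜ c j := by
    refine leftTensor_induction (p := fun t => ∃ c : Fin (Module.finrank k V) → A,
      t = ∑ j, (b j : A) ⊗ₜ c j) (fun v hv a => ?_) ⟨0, by simp⟩ ?_ ht
    · refine ⟨fun j => b.repr ⟨v, hv⟩ j • a, ?_⟩
      simp_rw [← TensorProduct.smul_tmul, ← TensorProduct.sum_tmul]
      congr 1
      have := congrArg V.subtype (b.sum_repr ⟨v, hv⟩)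
      simpa [-Module.Basis.sum_repr] using this.symm
    · rintro _ _ ⟨c, rfl⟩ ⟨d, rfl⟩
      exact ⟨c + d, by simp [TensorProduct.tmul_add, Finset.sum_add_distrib]⟩
  choose c hc using fun i => hex _ (hV' (b i) (b i).2)
  -- Coordinate functionals extended to `A`: contracting `Δ (b i)` with `φ l` recovers the matrix
  -- entry, so coassociativity gives the multiplicativity of the matrix.
  choose φ hφ using fun l => LinearMap.exists_extend (b.coord l)
  have hφb (l i) : φ l (b i) = if l = i then 1 else 0 := by
    have := LinearMap.congr_fun (hφ l) (b i)
    simp only [LinearMap.comp_apply, Submodule.subtype_apply, Module.Basis.coord_apply,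
      Module.Basis.repr_self, Finsupp.single_apply] at this
    rw [this]
    simp only [eq_comm]
  have hM (l i) : c i l = contractLeft A (φ l) (comul (b i : A)) := by
    rw [hc, map_sum]
    simp [hφb]
  refine ⟨_, fun i => (b i : A), Matrix.of fun j i => c i j, by rwa [hspan], hc,
    fun l i => ?_, fun l i => ?_⟩
  · simp only [Matrix.of_apply]
    rw [hM, comul_contractLeft]
    conv_lhs => rw [hc i]
    rw [map_sum]
    refine Finset.sum_congr rfl fun j _ => ?_
    rw [LinearMap.rTensor_tmul, LinearMap.comp_apply, ← hM]
  · simp only [Matrix.of_apply]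
    rw [hM, counit_contractLeft_comul, hφb]

/-- The antipode axiom read entrywise. -/
theorem antipode_comatrix {n : ℕ} {M : Matrix (Fin n) (Fin n) A}
    (hΔ : ∀ l i, comul (R := k) (M l i) = ∑ j, M l j ⊗ₜ M j i)
    (hε : ∀ l i, counit (R := k) (M l i) = if l = i then 1 else 0) :
    M * M.map (antipode k) = 1 := by
  ext l i
  have h := mul_antipode_lTensor_comul_apply (R := k) (M l i)
  rw [hΔ, hε, map_sum, map_sum] at h
  rw [Matrix.mul_apply, Matrix.one_apply]
  simpa [apply_ite] using h

/-- As `A` is commutative, `S` is an algebra map; applied to `M * S(M) = 1` it shows that `S(S(M))`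
and `M` are both inverse to `S(M)`. -/
theorem antipode_antipode_comatrix {n : ℕ} {M : Matrix (Fin n) (Fin n) A}
    (hΔ : ∀ l i, comul (R := k) (M l i) = ∑ j, M l j ⊗ₜ M j i)
    (hε : ∀ l i, counit (R := k) (M l i) = if l = i then 1 else 0) (l i : Fin n) :
    antipode k (antipode k (M l i)) = M l i := by
  have h1 := antipode_comatrix hΔ hε
  have h2 : M.map (antipode k) * (M.map (antipode k)).map (antipode k) = 1 := by
    have := congrArg (antipodeAlgHom k A).mapMatrix h1
    rw [map_mul, map_one] at this
    exact this
  have h3 : (M.map (antipode k)).map (antipode k) = M := by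
    rw [← one_mul ((M.map (antipode k)).map _), ← h1, mul_assoc, h2, mul_one]
  exact congrFun (congrFun h3 l) i

/-- Both sides are inverses of `Δ(M) = (M ⊗ 1)(1 ⊗ M)`, which reverses the order of the factors. -/
theorem comul_antipode_comatrix {n : ℕ} {M : Matrix (Fin n) (Fin n) A}
    (hΔ : ∀ l i, comul (R := k) (M l i) = ∑ j, M l j ⊗ₜ M j i)
    (hε : ∀ l i, counit (R := k) (M l i) = if l = i then 1 else 0) (l i : Fin n) :
    comul (R := k) (antipode k (M l i)) =
      ∑ j, antipode k (M j i) ⊗ₜ antipode k (M l j) := by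
  have h1 := antipode_comatrix hΔ hε
  let i₁ : A →ₐ[k] A ⊗[k] A := Algebra.TensorProduct.includeLeft
  let i₂ : A →ₐ[k] A ⊗[k] A := Algebra.TensorProduct.includeRight
  let N := M.map (antipode k)
  have hM : (Bialgebra.comulAlgHom k A).mapMatrix M = i₁.mapMatrix M * i₂.mapMatrix M := by
    ext l i
    simp [Matrix.mul_apply, hΔ, i₁, i₂]
  have hN : i₁.mapMatrix M * i₂.mapMatrix M * (i₂.mapMatrix N * i₁.mapMatrix N) = 1 := by
    rw [mul_assoc, ← mul_assoc (i₂.mapMatrix M), ← map_mul i₂.mapMatrix, h1, map_one, one_mul,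
      ← map_mul, h1, map_one]
  have hN' : (Bialgebra.comulAlgHom k A).mapMatrix N * (i₁.mapMatrix M * i₂.mapMatrix M) = 1 := by
    rw [← hM, ← map_mul, mul_eq_one_comm.mp h1, map_one]
  have h := congrArg (fun P => P l i) (left_inv_eq_right_inv hN' hN)
  simpa [Matrix.mul_apply, i₁, i₂, N] using h

/-- Every element of a commutative Hopf algebra lies in a finitely generated Hopf subalgebra. -/
theorem exists_fg_hopfSubalgebra (x : A) : ∃ B : Subalgebra k A, B.FG ∧ x ∈ B ∧
    (∀ b ∈ B, comul b ∈ (Algebra.TensorProduct.map B.val B.val).range) ∧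
    ∀ b ∈ B, antipode k b ∈ B := by
  classical
  obtain ⟨n, b, M, hx, hb, hΔ, hε⟩ := exists_comatrix (k := k) x
  -- The entries of `M` and of `S(M)`: the comatrix formulas make the algebra they generate stable
  -- under `Δ` and `S`.
  let s : Set A := Set.range (fun p : Fin n × Fin n => M p.1 p.2) ∪
    Set.range (fun p : Fin n × Fin n => antipode k (M p.1 p.2))
  let B := Algebra.adjoin k s
  have hMB (l i) : M l i ∈ B := Algebra.subset_adjoin (Or.inl ⟨(l, i), rfl⟩)
  have hSB (l i) : antipode k (M l i) ∈ B := Algebra.subset_adjoin (Or.inr ⟨(l, i), rfl⟩)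
  have htmul {a b : A} (ha : a ∈ B) (hb : b ∈ B) :
      a ⊗ₜ[k] b ∈ (Algebra.TensorProduct.map B.val B.val).range :=
    ⟨⟨a, ha⟩ ⊗ₜ ⟨b, hb⟩, rfl⟩
  refine ⟨B, ?_, ?_, ?_, ?_⟩
  · have hs : s.Finite := (Set.finite_range _).union (Set.finite_range _)
    exact ⟨hs.toFinset, by rw [hs.coe_toFinset]⟩
  · have hle : Submodule.span k (Set.range b) ≤ Subalgebra.toSubmodule B := by
      rw [Submodule.span_le]
      rintro _ ⟨i, rfl⟩
      have h := contractLeft_counit (k := k) (b i)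
      rw [hb, map_sum] at h
      rw [← h]
      refine Submodule.sum_mem _ fun j _ => ?_
      rw [contractLeft_tmul]
      exact Submodule.smul_mem _ _ (hMB j i)
    exact hle hx
  · have hle : B ≤ (Algebra.TensorProduct.map B.val B.val).range.comap
        (Bialgebra.comulAlgHom k A) := by
      refine Algebra.adjoin_le ?_
      rintro _ (⟨⟨l, i⟩, rfl⟩ | ⟨⟨l, i⟩, rfl⟩)
      · change comul (R := k) (M l i) ∈ (Algebra.TensorProduct.map B.val B.val).range
        rw [hΔ]
        exact sum_mem fun j _ => htmul (hMB _ _) (hMB _ _)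
      · change comul (R := k) (antipode k (M l i)) ∈ (Algebra.TensorProduct.map B.val B.val).range
        rw [comul_antipode_comatrix hΔ hε]
        exact sum_mem fun j _ => htmul (hSB _ _) (hSB _ _)
    exact fun b hb => hle hb
  · have hle : B ≤ B.comap (antipodeAlgHom k A) := by
      refine Algebra.adjoin_le ?_
      rintro _ (⟨⟨l, i⟩, rfl⟩ | ⟨⟨l, i⟩, rfl⟩)
      · exact hSB l i
      · change antipode k (antipode k (M l i)) ∈ B
        rw [antipode_antipode_comatrix hΔ hε]
        exact hMB l i
    exact fun b hb => hle hb

end Coalgebra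

/-! ### The Hopf structure on a stable subalgebra -/

section Subalgebra

variable [HopfAlgebra k A] (B : Subalgebra k A)

/-- Everything is flat over a field. Hence the Hopf axioms of `B` may be checked in tensor powers of
`A`. -/
theorem tensorMap_val_injective :
    Function.Injective (Algebra.TensorProduct.map B.val B.val) :=
  TensorProduct.map_injective_of_flat_flat (Subalgebra.toSubmodule B).subtype
    (Subalgebra.toSubmodule B).subtype Subtype.val_injective Subtype.val_injective

variable (hΔ : ∀ b ∈ B, comul b ∈ (Algebra.TensorProduct.map B.val B.val).range)
  (hS : ∀ b ∈ B, antipode k b ∈ B)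

/-- The comultiplication of a Hopf subalgebra. -/
def subalgebraComul : B →ₐ[k] B ⊗[k] B :=
  (AlgEquiv.ofInjective _ (tensorMap_val_injective B)).symm.toAlgHom.comp
    (((Bialgebra.comulAlgHom k A).comp B.val).codRestrict _ fun b => hΔ b b.2)

theorem map_subalgebraComul (b : B) :
    Algebra.TensorProduct.map B.val B.val (subalgebraComul B hΔ b) = comul (b : A) :=
  congrArg Subtype.val ((AlgEquiv.ofInjective _ (tensorMap_val_injective B)).apply_symm_apply
    (((Bialgebra.comulAlgHom k A).comp B.val).codRestrict _ (fun b => hΔ b b.2) b))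

theorem map_comp_subalgebraComul :
    (Algebra.TensorProduct.map B.val B.val).comp (subalgebraComul B hΔ) =
      (Bialgebra.comulAlgHom k A).comp B.val :=
  AlgHom.ext (map_subalgebraComul B hΔ)

/-- The bialgebra structure on a Hopf subalgebra. -/
@[reducible]
def subalgebraBialgebra : Bialgebra k B :=
  Bialgebra.ofAlgHom (subalgebraComul B hΔ) ((Bialgebra.counitAlgHom k A).comp B.val)
    (by
      have hinj : Function.Injective (Algebra.TensorProduct.map B.val
          (Algebra.TensorProduct.map B.val B.val)) :=
        TensorProduct.map_injective_of_flat_flat (Subalgebra.toSubmodule B).subtype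
          (Algebra.TensorProduct.map B.val B.val).toLinearMap Subtype.val_injective
          (tensorMap_val_injective B)
      have h1 : (Algebra.TensorProduct.map B.val (Algebra.TensorProduct.map B.val B.val)).comp
          ((Algebra.TensorProduct.assoc k k k B B B).toAlgHom.comp
            (Algebra.TensorProduct.map (subalgebraComul B hΔ) (.id k B))) =
          ((Algebra.TensorProduct.assoc k k k A A A).toAlgHom.comp
            (Algebra.TensorProduct.map (Bialgebra.comulAlgHom k A) (.id k A))).comp
            (Algebra.TensorProduct.map B.val B.val) := by
        have h2 : (Algebra.TensorProduct.map B.val (Algebra.TensorProduct.map B.val B.val)).comp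
            (Algebra.TensorProduct.assoc k k k B B B).toAlgHom =
            (Algebra.TensorProduct.assoc k k k A A A).toAlgHom.comp
              (Algebra.TensorProduct.map (Algebra.TensorProduct.map B.val B.val) B.val) := by
          ext <;> rfl
        rw [← AlgHom.comp_assoc, h2, AlgHom.comp_assoc, AlgHom.comp_assoc,
          ← Algebra.TensorProduct.map_comp, ← Algebra.TensorProduct.map_comp,
          map_comp_subalgebraComul]
        rfl
      have h3 : (Algebra.TensorProduct.map B.val (Algebra.TensorProduct.map B.val B.val)).comp
          (Algebra.TensorProduct.map (.id k B) (subalgebraComul B hΔ)) =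
          (Algebra.TensorProduct.map (.id k A) (Bialgebra.comulAlgHom k A)).comp
            (Algebra.TensorProduct.map B.val B.val) := by
        rw [← Algebra.TensorProduct.map_comp, ← Algebra.TensorProduct.map_comp,
          map_comp_subalgebraComul]
        rfl
      refine AlgHom.ext fun b => hinj ?_
      refine (AlgHom.congr_fun h1 (subalgebraComul B hΔ b)).trans
        (Eq.trans ?_ (AlgHom.congr_fun h3 (subalgebraComul B hΔ b)).symm)
      rw [AlgHom.comp_apply, AlgHom.comp_apply, AlgHom.comp_apply, map_subalgebraComul]
      exact coassoc_apply (R := k) (b : A))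
    (by
      have hinj : Function.Injective (Algebra.TensorProduct.map (AlgHom.id k k) B.val) :=
        TensorProduct.map_injective_of_flat_flat LinearMap.id
          (Subalgebra.toSubmodule B).subtype Function.injective_id Subtype.val_injective
      refine AlgHom.ext fun b => hinj ?_
      have h : (Algebra.TensorProduct.map (AlgHom.id k k) B.val).comp (Algebra.TensorProduct.map
          ((Bialgebra.counitAlgHom k A).comp B.val) (.id k B)) =
          (Algebra.TensorProduct.map (Bialgebra.counitAlgHom k A) (.id k A)).comp
            (Algebra.TensorProduct.map B.val B.val) := by
        rw [← Algebra.TensorProduct.map_comp, ← Algebra.TensorProduct.map_comp]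
        rfl
      refine (AlgHom.congr_fun h (subalgebraComul B hΔ b)).trans ?_
      rw [AlgHom.comp_apply, map_subalgebraComul]
      exact rTensor_counit_comul (R := k) (b : A))
    (by
      have hinj : Function.Injective (Algebra.TensorProduct.map B.val (AlgHom.id k k)) :=
        TensorProduct.map_injective_of_flat_flat (Subalgebra.toSubmodule B).subtype LinearMap.id
          Subtype.val_injective Function.injective_id
      refine AlgHom.ext fun b => hinj ?_
      have h : (Algebra.TensorProduct.map B.val (AlgHom.id k k)).comp (Algebra.TensorProduct.map
          (.id k B) ((Bialgebra.counitAlgHom k A).comp B.val)) =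
          (Algebra.TensorProduct.map (.id k A) (Bialgebra.counitAlgHom k A)).comp
            (Algebra.TensorProduct.map B.val B.val) := by
        rw [← Algebra.TensorProduct.map_comp, ← Algebra.TensorProduct.map_comp]
        rfl
      refine (AlgHom.congr_fun h (subalgebraComul B hΔ b)).trans ?_
      rw [AlgHom.comp_apply, map_subalgebraComul]
      exact lTensor_counit_comul (R := k) (b : A))

/-- The Hopf algebra structure on a Hopf subalgebra. -/
@[reducible]
def subalgebraHopfAlgebra : HopfAlgebra k B :=
  letI := subalgebraBialgebra B hΔ
  HopfAlgebra.ofAlgHom (((antipodeAlgHom k A).comp B.val).codRestrict B fun b => hS b b.2)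
    (by
      refine AlgHom.ext fun b => Subtype.val_injective ?_
      have h : B.val.comp (Algebra.TensorProduct.lift
          (((antipodeAlgHom k A).comp B.val).codRestrict B fun b => hS b b.2)
          (.id k B) fun _ _ => Commute.all _ _) =
          (Algebra.TensorProduct.lift (antipodeAlgHom k A) (.id k A)
            fun _ _ => Commute.all _ _).comp (Algebra.TensorProduct.map B.val B.val) := by
        ext
        · simp; rfl
        · simp
      refine (AlgHom.congr_fun h (subalgebraComul B hΔ b)).trans ?_
      rw [AlgHom.comp_apply, map_subalgebraComul]
      refine Eq.trans ?_ (mul_antipode_rTensor_comul_apply (R := k) (b : A))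
      rw [← Algebra.TensorProduct.lmul'_comp_map]
      rfl)
    (by
      refine AlgHom.ext fun b => Subtype.val_injective ?_
      have h : B.val.comp (Algebra.TensorProduct.lift (.id k B)
          (((antipodeAlgHom k A).comp B.val).codRestrict B fun b => hS b b.2)
          fun _ _ => Commute.all _ _) =
          (Algebra.TensorProduct.lift (.id k A) (antipodeAlgHom k A)
            fun _ _ => Commute.all _ _).comp (Algebra.TensorProduct.map B.val B.val) := by
        ext
        · simp
        · simp; rfl
      refine (AlgHom.congr_fun h (subalgebraComul B hΔ b)).trans ?_
      rw [AlgHom.comp_apply, map_subalgebraComul]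
      refine Eq.trans ?_ (mul_antipode_lTensor_comul_apply (R := k) (b : A))
      rw [← Algebra.TensorProduct.lmul'_comp_map]
      rfl)

/-- The inclusion of a Hopf subalgebra as a morphism of bialgebras. -/
def subalgebraBialgHom :
    letI := subalgebraHopfAlgebra B hΔ hS
    B →ₐc[k] A :=
  letI := subalgebraHopfAlgebra B hΔ hS
  BialgHom.ofAlgHom B.val rfl (map_comp_subalgebraComul B hΔ)

end Subalgebra

/-- Every element of a commutative Hopf algebra is in the image of an injective morphism from
a finitely generated commutative Hopf algebra. -/
theorem exists_finiteType_bialgHom {k A : Type u} [Field k] [CommRing A] [HopfAlgebra k A]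
    (x : A) : ∃ (B : Type u) (_ : CommRing B) (_ : HopfAlgebra k B) (f : B →ₐc[k] A) (b : B),
      Algebra.FiniteType k B ∧ Function.Injective f ∧ f b = x := by
  obtain ⟨B, hfg, hx, hΔ, hS⟩ := exists_fg_hopfSubalgebra (k := k) x
  exact ⟨B, inferInstance, subalgebraHopfAlgebra B hΔ hS, subalgebraBialgHom B hΔ hS, ⟨x, hx⟩,
    B.fg_iff_finiteType.mp hfg, Subtype.val_injective, rfl⟩

end HopfAlgebra

/-! ### Fibres of subcomodules over a Hopf subalgebra -/

namespace HopfAlgebra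

open TensorProduct Coalgebra

section Matrix

variable {R : Type*} [CommRing R]

/-- Some prime misses `t`; over the fraction field of the quotient the product has rank `d` and
factors through dimension `s`. -/
theorem le_of_matrix_mul_eq_smul_one {d s : ℕ} {t : R} (ht : ¬ IsNilpotent t)
    (Q : Matrix (Fin d) (Fin s) R) (P : Matrix (Fin s) (Fin d) R)
    (h : Q * P = t • (1 : Matrix (Fin d) (Fin d) R)) : d ≤ s := by
  have : ∃ p : Ideal R, p.IsPrime ∧ t ∉ p := by
    by_contra! hp
    exact ht (nilpotent_iff_mem_prime.mpr hp)
  obtain ⟨p, hp, htp⟩ := this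
  let θ : R →+* FractionRing (R ⧸ p) :=
    (algebraMap (R ⧸ p) (FractionRing (R ⧸ p))).comp (Ideal.Quotient.mk p)
  have hθ : θ t ≠ 0 := by
    intro h0
    have h1 : Ideal.Quotient.mk p t = 0 :=
      FaithfulSMul.algebraMap_injective (R ⧸ p) (FractionRing (R ⧸ p)) (h0.trans (map_zero _).symm)
    exact htp (Ideal.Quotient.eq_zero_iff_mem.mp h1)
  have hmap : Q.map θ * P.map θ = θ t • (1 : Matrix (Fin d) (Fin d) _) := by
    rw [← Matrix.map_mul, h]
    ext i j
    by_cases hij : i = j <;> simp [hij]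
  have hrank : (θ t • (1 : Matrix (Fin d) (Fin d) (FractionRing (R ⧸ p)))).rank = d := by
    rw [Matrix.rank_of_isUnit, Fintype.card_fin]
    exact (Units.mk0 _ hθ • (1 : (Matrix (Fin d) (Fin d) (FractionRing (R ⧸ p)))ˣ)).isUnit
  rw [← hrank, ← hmap]
  exact (Matrix.rank_mul_le_right _ _).trans ((P.map θ).rank_le_height)

/-- `det P` kills `y` by the adjugate, and `det Q * det P = t ^ r`. -/
theorem pow_mul_eq_zero_of_vecMul_eq_zero {r : ℕ} {t : R} (Q P : Matrix (Fin r) (Fin r) R)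
    (h : Q * P = t • (1 : Matrix (Fin r) (Fin r) R)) {y : Fin r → R}
    (hy : Matrix.vecMul y P = 0) (l : Fin r) : t ^ r * y l = 0 := by
  have h1 : Q.det * P.det = t ^ r := by
    rw [← Matrix.det_mul, h, Matrix.det_smul, Matrix.det_one, mul_one, Fintype.card_fin]
  have h2 : P.det • y = 0 := by
    have := congrArg (fun z => Matrix.vecMul z P.adjugate) hy
    simpa [Matrix.vecMul_vecMul, Matrix.mul_adjugate, Matrix.vecMul_smul] using this
  have h3 := congrFun h2 l
  rw [Pi.smul_apply, smul_eq_mul, Pi.zero_apply] at h3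
  rw [← h1, mul_assoc, h3, mul_zero]

end Matrix

variable {k A B : Type*} [Field k] [CommRing A] [HopfAlgebra k A] [CommRing B] [HopfAlgebra k B]

/-- The translation of a commutative Hopf algebra by a character. -/
def translate (β : B →ₐ[k] k) : B →ₐ[k] B :=
  (Algebra.TensorProduct.lid k B).toAlgHom.comp
    ((Algebra.TensorProduct.map β (AlgHom.id k B)).comp (Bialgebra.comulAlgHom k B))

theorem translate_counit (b : B) : translate (Bialgebra.counitAlgHom k B) b = b :=
  contractLeft_counit (k := k) b

/-- The left side is `β` of `∑ b₁ S(b₂) = ε(b)`. So a translate by `β`, evaluated at the inverse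
point, returns the value at the identity. -/
theorem comp_antipode_translate (β : B →ₐ[k] k) (b : B) :
    β (antipode k (translate β b)) = counit (R := k) b := by
  have h : (β.comp (antipodeAlgHom k B)).comp ((Algebra.TensorProduct.lid k B).toAlgHom.comp
      (Algebra.TensorProduct.map β (AlgHom.id k B))) =
      β.comp ((Algebra.TensorProduct.lmul' k).comp
        (Algebra.TensorProduct.map (AlgHom.id k B) (antipodeAlgHom k B))) := by
    ext x <;> simp
  refine (AlgHom.congr_fun h (comul b)).trans ?_
  have h2 := congrArg β (mul_antipode_lTensor_comul_apply (R := k) b)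
  rw [AlgHom.commutes] at h2
  exact h2

variable [Algebra B A] [IsScalarTower k B A]

variable (k) in
/-- A submodule over a Hopf subalgebra which is also a right subcomodule. -/
def IsSubcomodule (N : Submodule B A) : Prop :=
  ∀ n ∈ N, comul (R := k) n ∈ leftTensor (N.restrictScalars k)

/-- A family of functionals on `A` defines a map to a free `A`-module. -/
def fiberMap {d : ℕ} (φ : Fin d → A →ₗ[k] k) : A →ₗ[k] (Fin d → A) :=
  LinearMap.pi fun i => contractLeft A (φ i) ∘ₗ comul

theorem fiberMap_apply {d : ℕ} (φ : Fin d → A →ₗ[k] k) (x : A) (i : Fin d) :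
    fiberMap φ x i = contractLeft A (φ i) (comul x) := rfl

/-- With `Δ n = ∑ n₁ ⊗ n₂`, the combination `∑ S(n₂) • fiberMap φ n₁` collapses to the constant
vector `φ(n)`. Hence the image of `N` spans the free module as soon as the `φ i` have a dual family
in `N`. -/
theorem algebraMap_mem_span_fiberMap {N : Submodule B A} (hN : IsSubcomodule k N) {d : ℕ}
    (φ : Fin d → A →ₗ[k] k) {n : A} (hn : n ∈ N) :
    (fun i => algebraMap k A (φ i n)) ∈ Submodule.span A (fiberMap φ '' (N : Set A)) := by
  have h (t : A ⊗[k] A) (ht : t ∈ leftTensor (N.restrictScalars k)) :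
      (fun i => LinearMap.mul' k A (TensorProduct.map
        (contractLeft A (φ i) ∘ₗ comul) (antipode k) t)) ∈
        Submodule.span A (fiberMap φ '' (N : Set A)) := by
    refine leftTensor_induction (p := fun t => (fun i => LinearMap.mul' k A (TensorProduct.map
      (contractLeft A (φ i) ∘ₗ comul) (antipode k) t)) ∈
        Submodule.span A (fiberMap φ '' (N : Set A))) (fun v hv a => ?_) ?_
      (fun s t hs ht => ?_) ht
    · have := Submodule.smul_mem (Submodule.span A (fiberMap φ '' (N : Set A))) (antipode k a)
        (Submodule.subset_span ⟨v, hv, rfl⟩)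
      convert this using 1
      ext i
      simp [fiberMap_apply, mul_comm]
    · simp only [map_zero]
      exact zero_mem _
    · simp only [map_add]
      exact add_mem hs ht
  convert h _ (hN n hn) using 2 with i
  rw [← counit_contractLeft_comul (φ i) n, ← mul_antipode_lTensor_comul_apply (R := k),
    comul_contractLeft]
  congr 1
  rw [← LinearMap.comp_apply, LinearMap.lTensor_comp_rTensor]

variable (hΔ : ∀ b : B, comul (R := k) (algebraMap B A b) = Algebra.TensorProduct.map
  (IsScalarTower.toAlgHom k B A) (IsScalarTower.toAlgHom k B A) (comul b))
  (hε : ∀ b : B, counit (R := k) (algebraMap B A b) = counit (R := k) b)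

include hΔ in
theorem isSubcomodule_span {V : Submodule k A} (hV : ∀ v ∈ V, comul v ∈ leftTensor V) :
    IsSubcomodule k (Submodule.span B (V : Set A)) := by
  have hle : V ≤ (Submodule.span B (V : Set A)).restrictScalars k :=
    fun v hv => Submodule.subset_span hv
  intro n hn
  induction hn using Submodule.span_induction with
  | mem v hv => exact leftTensor_mono hle (hV v hv)
  | zero => rw [map_zero]; exact zero_mem _
  | add v w _ _ hv hw => rw [map_add]; exact add_mem hv hw
  | smul b v _ hv =>
    rw [Algebra.smul_def, Bialgebra.comul_mul, hΔ]
    generalize comul (R := k) b = u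
    refine leftTensor_induction (p := fun t => _ * t ∈ leftTensor _) (fun v hv a => ?_) ?_
      (fun s t hs ht => ?_) hv
    · induction u using TensorProduct.induction_on with
      | zero => simp
      | add u u' hu hu' => rw [map_add, add_mul]; exact add_mem hu hu'
      | tmul x y =>
        rw [Algebra.TensorProduct.map_tmul, Algebra.TensorProduct.tmul_mul_tmul]
        refine tmul_mem_leftTensor ?_ _
        rw [IsScalarTower.coe_toAlgHom', ← Algebra.smul_def]
        exact Submodule.smul_mem _ x hv
    · rw [mul_zero]; exact zero_mem _
    · rw [mul_add]; exact add_mem hs ht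

include hΔ in
theorem exists_isSubcomodule {s : Set A} (hs : s.Finite) :
    ∃ N : Submodule B A, N.FG ∧ s ⊆ N ∧ IsSubcomodule k N := by
  obtain ⟨V, ⟨t, ht⟩, hsV, hV⟩ := exists_fg_subcomodule_of_finite (k := k) hs
  refine ⟨Submodule.span B (V : Set A), ⟨t, ?_⟩, hsV.trans Submodule.subset_span,
    isSubcomodule_span hΔ hV⟩
  rw [← ht, Submodule.span_span_of_tower]

/-- A functional on `A` is equivariant on `N` with respect to a character `β`. -/
def IsEquivariant (β : B →ₐ[k] k) (N : Submodule B A) (φ : A →ₗ[k] k) : Prop :=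
  ∀ n ∈ N, ∀ b : B, φ (b • n) = β b * φ n

include hΔ in
-- `Δ(bn) = Δ(b)Δ(n)`, and equivariance lets `φ i` pull the first leg of `Δ(b)` out as its value
-- under `β`.
theorem fiberMap_smul {N : Submodule B A} (hN : IsSubcomodule k N) {d : ℕ}
    {φ : Fin d → A →ₗ[k] k} {β : B →ₐ[k] k} (hφ : ∀ i, IsEquivariant β N (φ i)) {n : A}
    (hn : n ∈ N) (b : B) :
    fiberMap φ (b • n) = algebraMap B A (translate β b) • fiberMap φ n := by
  ext i
  rw [Pi.smul_apply, fiberMap_apply, fiberMap_apply, Algebra.smul_def, Bialgebra.comul_mul, hΔ]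
  change _ = algebraMap B A (Algebra.TensorProduct.lid k B
    (Algebra.TensorProduct.map β (AlgHom.id k B) (comul b))) • _
  generalize comul (R := k) b = u
  refine leftTensor_induction (p := fun t => contractLeft A (φ i) (_ * t) =
    _ • contractLeft A (φ i) t) (fun v hv a => ?_) ?_ (fun s t hs ht => ?_) (hN n hn)
  · induction u using TensorProduct.induction_on with
    | zero => simp
    | add u u' hu hu' =>
      rw [map_add, add_mul, map_add, hu, hu', map_add, map_add, map_add, add_smul]
    | tmul x y =>
      rw [Algebra.TensorProduct.map_tmul, Algebra.TensorProduct.tmul_mul_tmul,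
        contractLeft_tmul, contractLeft_tmul, IsScalarTower.coe_toAlgHom', ← Algebra.smul_def,
        hφ i v hv x]
      simp only [Algebra.TensorProduct.map_tmul, AlgHom.coe_id, id_eq,
        Algebra.TensorProduct.lid_tmul, smul_eq_mul, Algebra.smul_def, map_mul,
        ← IsScalarTower.algebraMap_apply]
      ring
  · simp
  · rw [mul_add, map_add, hs, ht, map_add, smul_add]

include hΔ in
-- The image of `N` spans all of `A^d`, and multiplication by the translate of `b` moves it into the
-- span of the `s` vectors coming from `w`; the rows of `Q` express the scaled standard basis in
-- these vectors.
theorem exists_matrix_mul_eq {N : Submodule B A} (hN : IsSubcomodule k N) {d s : ℕ}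
    {φ : Fin d → A →ₗ[k] k} {β : B →ₐ[k] k} (hφ : ∀ i, IsEquivariant β N (φ i))
    {v : Fin d → A} (hv : ∀ j, v j ∈ N) (hφv : ∀ i j, φ i (v j) = if i = j then 1 else 0)
    {w : Fin s → A} (hw : ∀ l, w l ∈ N) {b : B}
    (hb : ∀ n ∈ N, b • n ∈ Submodule.span B (Set.range w)) :
    ∃ Q : Matrix (Fin d) (Fin s) A, Q * Matrix.of (fun l => fiberMap φ (w l)) =
      algebraMap B A (translate β b) • (1 : Matrix (Fin d) (Fin d) A) := by
  have key (y : Fin d → A) (hy : y ∈ Submodule.span A (fiberMap φ '' (N : Set A))) :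
      algebraMap B A (translate β b) • y ∈
        Submodule.span A (Set.range fun l => fiberMap φ (w l)) := by
    induction hy using Submodule.span_induction with
    | zero => rw [smul_zero]; exact zero_mem _
    | add y z _ _ hy hz => rw [smul_add]; exact add_mem hy hz
    | smul a y _ hy => rw [smul_comm]; exact Submodule.smul_mem _ a hy
    | mem y hy =>
      obtain ⟨n, hn, rfl⟩ := hy
      rw [← fiberMap_smul hΔ hN hφ hn]
      obtain ⟨c, hc⟩ := (Submodule.mem_span_range_iff_exists_fun B).mp (hb n hn)
      rw [← hc, map_sum]
      refine Submodule.sum_mem _ fun l _ => ?_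
      rw [fiberMap_smul hΔ hN hφ (hw l)]
      exact Submodule.smul_mem _ _ (Submodule.subset_span ⟨l, rfl⟩)
  choose Q hQ using fun j => (Submodule.mem_span_range_iff_exists_fun A).mp
    (key _ (algebraMap_mem_span_fiberMap hN φ (hv j)))
  refine ⟨Matrix.of Q, ?_⟩
  ext j i
  have h := congrFun (hQ j) i
  rw [Finset.sum_apply] at h
  rw [Matrix.mul_apply, Matrix.smul_apply, Matrix.one_apply]
  refine h.trans ?_
  rw [Pi.smul_apply, hφv]
  simp only [eq_comm, apply_ite (algebraMap k A), map_one, map_zero]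

/-- A basis of the fibre `N / (ker β) N` is lifted to `v`, its coordinates are extended to `φ`, and
Nakayama's lemma makes `v` generate `N` after multiplication by some `b` outside `ker β`. -/
theorem exists_fiber_data {N : Submodule B A} (hfg : N.FG) (β : B →ₐ[k] k) :
    ∃ (d : ℕ) (φ : Fin d → A →ₗ[k] k) (v : Fin d → A) (b : B), (∀ j, v j ∈ N) ∧
      (∀ i j, φ i (v j) = if i = j then 1 else 0) ∧ (∀ i, IsEquivariant β N (φ i)) ∧
      β b ≠ 0 ∧ ∀ n ∈ N, b • n ∈ Submodule.span B (Set.range v) := by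
  classical
  let I : Ideal B := RingHom.ker β
  let Q := N ⧸ (I • ⊤ : Submodule B N)
  let q : N →ₗ[B] Q := (I • ⊤ : Submodule B N).mkQ
  have hq (c : B) (n : N) : q (c • n) = β c • q n := by
    have h1 : c - algebraMap k B (β c) ∈ I := by
      rw [RingHom.mem_ker]
      simp
    have h2 : q ((c - algebraMap k B (β c)) • n) = 0 :=
      (Submodule.Quotient.mk_eq_zero _).mpr (Submodule.smul_mem_smul h1 Submodule.mem_top)
    have h3 : (c - algebraMap k B (β c)) • n = c • n - β c • n :=
      Subtype.ext (by simp [sub_smul])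
    rw [h3, map_sub, sub_eq_zero] at h2
    rw [h2]
    exact (q.restrictScalars k).map_smul _ _
  have hfin : Module.Finite k Q := by
    obtain ⟨t, ht⟩ := hfg
    have htop : Submodule.span B ((↑) ⁻¹' (t : Set A) : Set N) = ⊤ := by
      subst ht
      exact Submodule.span_span_coe_preimage
    refine ⟨⟨(t.finite_toSet.preimage Subtype.val_injective.injOn |>.image q).toFinset, ?_⟩⟩
    rw [Set.Finite.coe_toFinset, eq_top_iff]
    rintro x -
    obtain ⟨n, rfl⟩ := Submodule.mkQ_surjective _ x
    have hn : n ∈ Submodule.span B ((↑) ⁻¹' (t : Set A) : Set N) := htop ▸ Submodule.mem_top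
    induction hn using Submodule.span_induction with
    | mem n hn => exact Submodule.subset_span ⟨n, hn, rfl⟩
    | zero => rw [map_zero]; exact zero_mem _
    | add m n _ _ hm hn => rw [map_add]; exact add_mem hm hn
    | smul c n _ hn => 
      change q (c • n) ∈ _
      rw [hq]
      exact Submodule.smul_mem _ _ hn
  let e := Module.finBasis k Q
  choose v hv using fun j => Submodule.mkQ_surjective _ (e j)
  choose φ hφ using fun i => LinearMap.exists_extend
    (p := N.restrictScalars k) (e.coord i ∘ₗ q.restrictScalars k)
  have hφ' (i) (n : N) : φ i n = e.coord i (q n) := LinearMap.congr_fun (hφ i) n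
  -- Nakayama's hypothesis for the image of `N` modulo the span of `v`; the resulting `b` is `1`
  -- modulo `ker β`.
  have hspan : N.map (Submodule.span B (Set.range fun j => (v j : A))).mkQ ≤
      I • N.map (Submodule.span B (Set.range fun j => (v j : A))).mkQ := by
    rintro _ ⟨n, hn, rfl⟩
    have h1 : q (⟨n, hn⟩ - ∑ j, algebraMap k B (e.repr (q ⟨n, hn⟩) j) • v j) = 0 := by
      rw [map_sub, map_sum, sub_eq_zero]
      conv_lhs => rw [← e.sum_repr (q ⟨n, hn⟩)]
      refine Finset.sum_congr rfl fun j _ => ?_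
      rw [hq, AlgHom.commutes]
      exact congrArg _ (hv j).symm
    have h2 := (Submodule.Quotient.mk_eq_zero _).mp h1
    have h3 := Submodule.mem_map_of_mem
      (f := (Submodule.span B (Set.range fun j => (v j : A))).mkQ ∘ₗ N.subtype) h2
    rw [Submodule.map_smul'', Submodule.map_comp, Submodule.map_top, Submodule.range_subtype] at h3
    have h4 : ((Submodule.span B (Set.range fun j => (v j : A))).mkQ ∘ₗ N.subtype)
        (∑ j, algebraMap k B (e.repr (q ⟨n, hn⟩) j) • v j) = 0 := by
      rw [LinearMap.comp_apply, Submodule.mkQ_apply, Submodule.Quotient.mk_eq_zero, map_sum]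
      refine Submodule.sum_mem _ fun j _ => ?_
      rw [map_smul]
      exact Submodule.smul_mem _ _ (Submodule.subset_span ⟨j, rfl⟩)
    rw [map_sub, h4, sub_zero] at h3
    exact h3
  obtain ⟨b, hb, hb'⟩ := Submodule.exists_sub_one_mem_and_smul_eq_zero_of_fg_of_le_smul I _
    (hfg.map _) hspan
  refine ⟨_, φ, fun j => v j, b, fun j => (v j).2, fun i j => ?_, fun i n hn c => ?_, ?_,
    fun n hn => ?_⟩
  · rw [hφ', show q (v j) = e j from hv j, Module.Basis.coord_apply, Module.Basis.repr_self,
      Finsupp.single_apply]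
    simp only [eq_comm]
  · have h1 := hφ' i (c • ⟨n, hn⟩)
    rw [hq, map_smul, ← hφ'] at h1
    exact h1
  · rw [RingHom.mem_ker, map_sub, map_one, sub_eq_zero] at hb
    rw [hb]
    exact one_ne_zero
  · have h1 := hb' _ ⟨n, hn, rfl⟩
    rwa [← map_smul, Submodule.mkQ_apply, Submodule.Quotient.mk_eq_zero] at h1

end HopfAlgebra

/-! ### Constant fibre dimension and faithful flatness -/

namespace HopfAlgebra

open TensorProduct Coalgebra

variable {k A B : Type*} [Field k] [CommRing A] [HopfAlgebra k A] [CommRing B] [HopfAlgebra k B]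
variable [Algebra B A] [IsScalarTower k B A]
variable (hΔ : ∀ b : B, comul (R := k) (algebraMap B A b) = Algebra.TensorProduct.map
  (IsScalarTower.toAlgHom k B A) (IsScalarTower.toAlgHom k B A) (comul b))
  (hinj : Function.Injective (algebraMap B A))

omit [HopfAlgebra k A] [IsScalarTower k B A] in
include hinj in
theorem not_isNilpotent_of_character {b : B} (χ : B →ₐ[k] k) (h : χ b ≠ 0) :
    ¬ IsNilpotent (algebraMap B A b) := by
  rw [IsNilpotent.map_iff hinj]
  exact fun hb => h (hb.map χ).eq_zero

include hΔ hinj in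
-- Local generators `w` near one point bound the fibre dimension at `β`: the character `χ`
-- guarantees that the translated denominator is not nilpotent.
theorem le_of_fiber_data {N : Submodule B A} (hN : IsSubcomodule k N) {d s : ℕ}
    {φ : Fin d → A →ₗ[k] k} {β : B →ₐ[k] k} (hφ : ∀ i, IsEquivariant β N (φ i))
    {v : Fin d → A} (hv : ∀ j, v j ∈ N) (hφv : ∀ i j, φ i (v j) = if i = j then 1 else 0)
    {w : Fin s → A} (hw : ∀ l, w l ∈ N) {b : B}
    (hb : ∀ n ∈ N, b • n ∈ Submodule.span B (Set.range w)) (χ : B →ₐ[k] k)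
    (hχ : χ (translate β b) ≠ 0) : d ≤ s := by
  obtain ⟨Q, hQ⟩ := exists_matrix_mul_eq hΔ hN hφ hv hφv hw hb
  exact le_of_matrix_mul_eq_smul_one (not_isNilpotent_of_character hinj χ hχ) Q _ hQ

include hΔ hinj in
-- With as many generators as functionals the matrix is square, so relations among the `w l` are
-- killed by a power of the translated denominator.
theorem pow_mul_eq_zero_of_fiberMap_eq_zero {N : Submodule B A} (hN : IsSubcomodule k N) {r : ℕ}
    {φ : Fin r → A →ₗ[k] k} {β : B →ₐ[k] k} (hφ : ∀ i, IsEquivariant β N (φ i))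
    {v : Fin r → A} (hv : ∀ j, v j ∈ N) (hφv : ∀ i j, φ i (v j) = if i = j then 1 else 0)
    {w : Fin r → A} (hw : ∀ l, w l ∈ N) {b : B}
    (hb : ∀ n ∈ N, b • n ∈ Submodule.span B (Set.range w)) {c : Fin r → B}
    (hc : fiberMap φ (∑ l, c l • w l) = 0) (l : Fin r) :
    translate β b ^ r * translate β (c l) = 0 := by
  obtain ⟨Q, hQ⟩ := exists_matrix_mul_eq hΔ hN hφ hv hφv hw hb
  apply hinj
  rw [map_mul, map_pow, map_zero]
  refine pow_mul_eq_zero_of_vecMul_eq_zero Q _ hQ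
    (y := fun l => algebraMap B A (translate β (c l))) ?_ l
  rw [map_sum] at hc
  rw [Matrix.vecMul_eq_sum, ← hc]
  refine Finset.sum_congr rfl fun l _ => ?_
  rw [fiberMap_smul hΔ hN hφ (hw l)]
  rfl

include hΔ hinj in
/-- Finitely generated subcomodules have constant fibre dimension. -/
theorem fiber_dim_eq {N : Submodule B A} (hN : IsSubcomodule k N) {d s : ℕ}
    {φ : Fin d → A →ₗ[k] k} {β : B →ₐ[k] k} (hφ : ∀ i, IsEquivariant β N (φ i))
    {v : Fin d → A} (hv : ∀ j, v j ∈ N) (hφv : ∀ i j, φ i (v j) = if i = j then 1 else 0)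
    {b : B} (hβb : β b ≠ 0) (hb : ∀ n ∈ N, b • n ∈ Submodule.span B (Set.range v))
    {ψ : Fin s → A →ₗ[k] k} (hψ : ∀ i, IsEquivariant (Bialgebra.counitAlgHom k B) N (ψ i))
    {w : Fin s → A} (hw : ∀ j, w j ∈ N) (hψw : ∀ i j, ψ i (w j) = if i = j then 1 else 0)
    {c : B} (hεc : Bialgebra.counitAlgHom k B c ≠ 0)
    (hc : ∀ n ∈ N, c • n ∈ Submodule.span B (Set.range w)) : d = s := by
  apply le_antisymm
  -- At the inverse of `β` the translate of `c` takes the value `ε(c)`, which is nonzero.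
  · refine le_of_fiber_data hΔ hinj hN hφ hv hφv hw hc (β.comp (antipodeAlgHom k B)) ?_
    change β (antipode k (translate β c)) ≠ 0
    rwa [comp_antipode_translate]
  · refine le_of_fiber_data hΔ hinj hN hψ hw hψw hv hb β ?_
    rwa [translate_counit]

include hΔ hinj in
/-- A commutative Hopf algebra is flat over a Hopf subalgebra all of whose maximal ideals are
rational. -/
theorem flat_of_rational
    (hrat : ∀ m : Ideal B, m.IsMaximal → ∃ β : B →ₐ[k] k, RingHom.ker β = m) :
    Module.Flat B A := by
  rw [Module.Flat.iff_forall_isTrivialRelation]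
  intro l f x hfx
  -- The `A`-span of the relations over `B`. By the equational criterion flatness amounts to `x ∈
  -- M`, which is checked locally on `B` through the ideal `J` of denominators.
  let M : Submodule A (Fin l → A) := Submodule.span A
    ((fun a i => algebraMap B A (a i)) '' {a : Fin l → B | ∑ i, f i * a i = 0})
  suffices hx : x ∈ M by
    obtain ⟨n, y, g, hg⟩ := Submodule.mem_span_set'.mp hx
    choose a ha ha' using fun j => (g j).2
    refine ⟨n, fun i j => a j i, y, fun i => ?_, fun j => ha j⟩
    rw [← hg, Finset.sum_apply]
    refine Finset.sum_congr rfl fun j _ => ?_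
    rw [Pi.smul_apply, ← ha', smul_eq_mul, Algebra.smul_def, mul_comm]
  let J : Ideal B := (M.restrictScalars B).comap (LinearMap.toSpanSingleton B (Fin l → A) x)
  have hJ (b : B) : b ∈ J ↔ b • x ∈ M := Iff.rfl
  suffices hJtop : J = ⊤ by
    have := (hJ 1).mp (hJtop ▸ Submodule.mem_top)
    rwa [one_smul] at this
  by_contra hne
  obtain ⟨m, hm, hJm⟩ := Ideal.exists_le_maximal J hne
  obtain ⟨β, hβ⟩ := hrat m hm
  obtain ⟨N, hfg, hxN, hN⟩ := exists_isSubcomodule hΔ (Set.finite_range x)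
  obtain ⟨d, φ, v, b, hv, hφv, hφ, hβb, hb⟩ := exists_fiber_data (k := k) hfg β
  obtain ⟨s, ψ, w, c, hw, hψw, hψ, hεc, hc⟩ :=
    exists_fiber_data (k := k) hfg (Bialgebra.counitAlgHom k B)
  obtain rfl := fiber_dim_eq hΔ hinj hN hφ hv hφv hβb hb hψ hw hψw hεc hc
  choose a ha using fun i => (Submodule.mem_span_range_iff_exists_fun B).mp
    (hb (x i) (hxN ⟨i, rfl⟩))
  have hrel : ∑ j, (∑ i, f i * a i j) • v j = 0 := by
    simp_rw [Finset.sum_smul]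
    rw [Finset.sum_comm]
    simp_rw [mul_smul, ← Finset.smul_sum, ha, smul_comm _ b]
    rw [← Finset.smul_sum, hfx, smul_zero]
  -- Use the functionals at the counit, where translation is the identity: the factor `b ^ d` comes
  -- from the `d × d` determinant. One more `b` is spent writing `x` in terms of `v`, whence the
  -- exponent `d + 1` below.
  have hzero (j : Fin d) : ∑ i, f i * (b ^ d * a i j) = 0 := by
    have := pow_mul_eq_zero_of_fiberMap_eq_zero hΔ hinj hN hψ hw hψw hv hb
      (c := fun j => ∑ i, f i * a i j) (by rw [hrel, map_zero]) j
    rw [translate_counit, translate_counit, Finset.mul_sum] at this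
    rw [← this]
    exact Finset.sum_congr rfl fun i _ => by ring
  have hmem : b ^ (d + 1) ∈ J := by
    rw [hJ]
    have hexp : b ^ (d + 1) • x =
        ∑ j, v j • fun i => algebraMap B A (b ^ d * a i j) := by
      ext i
      rw [Pi.smul_apply, pow_succ, mul_smul, ← ha, Finset.smul_sum, Finset.sum_apply]
      refine Finset.sum_congr rfl fun j _ => ?_
      rw [Pi.smul_apply, ← mul_smul, Algebra.smul_def, smul_eq_mul, mul_comm]
    rw [hexp]
    exact Submodule.sum_mem _ fun j _ => Submodule.smul_mem _ _
      (Submodule.subset_span ⟨_, hzero j, rfl⟩)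
  have h0 : β (b ^ (d + 1)) = 0 := by
    have := hJm hmem
    rwa [← hβ] at this
  rw [map_pow] at h0
  exact hβb (pow_eq_zero_iff (Nat.succ_ne_zero d) |>.mp h0)

include hΔ hinj in
/-- A commutative Hopf algebra is faithfully flat over a Hopf subalgebra all of whose maximal
ideals are rational. -/
theorem faithfullyFlat_of_rational
    (hε : ∀ b : B, counit (R := k) (algebraMap B A b) = counit (R := k) b)
    (hrat : ∀ m : Ideal B, m.IsMaximal → ∃ β : B →ₐ[k] k, RingHom.ker β = m) :
    Module.FaithfullyFlat B A := by
  have hflat := flat_of_rational hΔ hinj hrat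
  refine ⟨fun {m} hm htop => ?_⟩
  obtain ⟨β, hβ⟩ := hrat m hm
  have hfin (x : A) (hx : x ∈ m • (⊤ : Submodule B A)) :
      ∃ s : Set A, s.Finite ∧ x ∈ m • Submodule.span B s := by
    refine Submodule.smul_induction_on (p := fun x => ∃ s : Set A, s.Finite ∧
      x ∈ m • Submodule.span B s) hx (fun c hc y _ => ?_) ?_
    · exact ⟨{y}, Set.finite_singleton y,
        Submodule.smul_mem_smul hc (Submodule.subset_span rfl)⟩
    · rintro y z ⟨s, hs, hy⟩ ⟨t, ht, hz⟩
      exact ⟨s ∪ t, hs.union ht, add_mem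
        (Submodule.smul_mono le_rfl (Submodule.span_mono Set.subset_union_left) hy)
        (Submodule.smul_mono le_rfl (Submodule.span_mono Set.subset_union_right) hz)⟩
  -- If `mA = A`, then already `1 ∈ mN` for a finitely generated subcomodule `N` containing `1`.
  obtain ⟨S, hS, h1S⟩ := hfin 1 (by rw [htop]; exact Submodule.mem_top)
  obtain ⟨N, hfg, hSN, hN⟩ := exists_isSubcomodule hΔ (hS.insert 1)
  have h1 : (1 : A) ∈ m • N := Submodule.smul_mono le_rfl
    (Submodule.span_le.mpr ((Set.subset_insert _ _).trans hSN)) h1S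
  obtain ⟨d, φ, v, b, hv, hφv, hφ, hβb, hb⟩ := exists_fiber_data (k := k) hfg β
  obtain ⟨s, ψ, w, c, hw, hψw, hψ, hεc, hc⟩ :=
    exists_fiber_data (k := k) hfg (Bialgebra.counitAlgHom k B)
  obtain rfl := fiber_dim_eq hΔ hinj hN hφ hv hφv hβb hb hψ hw hψw hεc hc
  obtain ⟨a, ha⟩ := (Submodule.mem_span_range_iff_exists_fun B).mp
    (hc 1 (hSN (Set.mem_insert _ _)))
  have hφ1 (i) : φ i 1 = 0 := by
    refine Submodule.smul_induction_on (p := fun x => φ i x = 0) h1 (fun e he y hy => ?_)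
      (fun y z hy hz => by rw [map_add, hy, hz, add_zero])
    rw [hφ i y hy, show β e = 0 by rwa [← hβ] at he, zero_mul]
  -- The sum is `c • 1`, and `fiberMap φ 1 = 0` because `1` vanishes in the fibre at `β`. Evaluating
  -- the resulting relations at the inverse of `β` gives `ε(a l) = 0`, hence `ε(c) = 0`, a
  -- contradiction.
  have hfib : fiberMap φ (∑ l, a l • w l) = 0 := by
    rw [ha, fiberMap_smul hΔ hN hφ (hSN (Set.mem_insert _ _))]
    convert smul_zero _
    ext i
    rw [fiberMap_apply, Bialgebra.comul_one, Algebra.TensorProduct.one_def, contractLeft_tmul,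
      hφ1, zero_smul, Pi.zero_apply]
  have hεa (l) : counit (R := k) (a l) = 0 := by
    have h2 := pow_mul_eq_zero_of_fiberMap_eq_zero hΔ hinj hN hφ hv hφv hw hc hfib l
    have h3 := congrArg (β.comp (antipodeAlgHom k B)) h2
    rw [map_mul, map_pow, map_zero] at h3
    change β (antipode k (translate β c)) ^ d * β (antipode k (translate β (a l))) = 0 at h3
    rw [comp_antipode_translate, comp_antipode_translate] at h3
    exact (mul_eq_zero.mp h3).resolve_left (pow_ne_zero _ hεc)
  have h4 := congrArg (counit (R := k) : A →ₗ[k] k) ha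
  rw [map_sum, Algebra.smul_def, mul_one, hε] at h4
  refine hεc (h4.symm.trans (Finset.sum_eq_zero fun l _ => ?_))
  rw [Algebra.smul_def, Bialgebra.counit_mul, hε, hεa, zero_mul]

omit [Algebra B A] [IsScalarTower k B A] in
/-- Over an algebraically closed field, an injective morphism from a finitely generated
commutative Hopf algebra to a commutative Hopf algebra is faithfully flat. -/
theorem faithfullyFlat_of_injective [IsAlgClosed k] (f : B →ₐc[k] A)
    [hft : Algebra.FiniteType k B] (hf : Function.Injective f) :
    (f : B →ₐ[k] A).toRingHom.FaithfullyFlat := by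
  let : Algebra B A := (f : B →ₐ[k] A).toRingHom.toAlgebra
  have : IsScalarTower k B A := IsScalarTower.of_algebraMap_eq fun x =>
    ((f : B →ₐ[k] A).commutes x).symm
  have hf' : IsScalarTower.toAlgHom k B A = (f : B →ₐ[k] A) := AlgHom.ext fun _ => rfl
  refine faithfullyFlat_of_rational (k := k) (fun b => ?_) hf (fun b => ?_) (fun m hm => ?_)
  · rw [hf']
    exact (CoalgHomClass.map_comp_comul_apply f b).symm
  · exact CoalgHomClass.counit_comp_apply f b
  -- Nullstellensatz: the residue field is finite over the algebraically closed `k`, hence equal to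
  -- it.
  · let _ := Ideal.Quotient.field m
    have : Module.Finite k (B ⧸ m) := finite_of_finite_type_of_isJacobsonRing k (B ⧸ m)
    let e := AlgEquiv.ofBijective (Algebra.ofId k (B ⧸ m))
      IsAlgClosed.algebraMap_bijective_of_isIntegral
    refine ⟨e.symm.toAlgHom.comp (Ideal.Quotient.mkₐ k m), ?_⟩
    ext b
    rw [RingHom.mem_ker]
    change e.symm (Ideal.Quotient.mk m b) = 0 ↔ _
    rw [EmbeddingLike.map_eq_zero_iff, Ideal.Quotient.eq_zero_iff_mem]

end HopfAlgebra

/-! ### Hopf algebras of functions on an abstract group -/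

namespace HopfAlgebra

open TensorProduct Coalgebra

section Separation

variable {k A B : Type*} [Field k] [CommRing A] [Algebra k A] [CommRing B] [Algebra k B]

/-- If families of characters separate the points of two algebras, then the products of these
characters separate the points of the tensor product. -/
theorem tensor_eq_of_characters {I J : Type*} (χ : I → A →ₐ[k] k) (ψ : J → B →ₐ[k] k)
    (hχ : ∀ a, (∀ i, χ i a = 0) → a = 0) (hψ : ∀ b, (∀ j, ψ j b = 0) → b = 0)
    {s t : A ⊗[k] B}
    (h : ∀ i j, Algebra.TensorProduct.lift (χ i) (ψ j) (fun _ _ => Commute.all _ _) s =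
      Algebra.TensorProduct.lift (χ i) (ψ j) (fun _ _ => Commute.all _ _) t) : s = t := by
  classical
  rw [← sub_eq_zero]
  replace h (i j) : Algebra.TensorProduct.lift (χ i) (ψ j) (fun _ _ => Commute.all _ _)
      (s - t) = 0 := by rw [map_sub, h, sub_self]
  generalize s - t = t at h
  -- Expand the difference along a basis of `B`. The `ψ j` show that applying `χ i` to the
  -- coefficients gives a vanishing combination of basis vectors; independence and the `χ i` then
  -- kill the coefficients.
  let e := Module.Basis.ofVectorSpace k B
  let c := TensorProduct.equivFinsuppOfBasisRight e t
  have hc : t = c.sum fun i m => m ⊗ₜ[k] e i := by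
    rw [← TensorProduct.equivFinsuppOfBasisRight_symm_apply, LinearEquiv.symm_apply_apply]
  suffices hc0 : c = 0 by rw [hc, hc0, Finsupp.sum_zero_index]
  ext m
  refine hχ _ fun i => ?_
  have h1 : ∑ m ∈ c.support, χ i (c m) • e m = 0 := by
    refine hψ _ fun j => ?_
    have := h i j
    rw [hc, Finsupp.sum, map_sum] at this
    rw [map_sum, ← this]
    refine Finset.sum_congr rfl fun m _ => ?_
    rw [Algebra.TensorProduct.lift_tmul, map_smul, smul_eq_mul]
  by_cases hm : m ∈ c.support
  · exact linearIndependent_iff'.mp e.linearIndependent _ _ h1 m hm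
  · rw [Finsupp.notMem_support_iff.mp hm, map_zero]

end Separation

section Functions

variable {k F : Type*} [Field k] (S : Subalgebra k (F → k))

/-- Evaluation at a point as a character of an algebra of functions. -/
def evalChar (g : F) : S →ₐ[k] k := (Pi.evalAlgHom k (fun _ => k) g).comp S.val

@[simp]
theorem evalChar_apply (g : F) (f : S) : evalChar S g f = f.1 g := rfl

theorem evalChar_separating (f : S) (h : ∀ g, evalChar S g f = 0) : f = 0 :=
  Subtype.ext (funext h)

/-- Evaluation of a tensor of functions at a pair of points. -/
def evalPair (p : F × F) : S ⊗[k] S →ₐ[k] k :=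
  Algebra.TensorProduct.lift (evalChar S p.1) (evalChar S p.2) fun _ _ => Commute.all _ _

@[simp]
theorem evalPair_tmul (p : F × F) (a b : S) : evalPair S p (a ⊗ₜ b) = a.1 p.1 * b.1 p.2 := rfl

variable {S} in
-- Tensors are thus functions on `F × F`, and the Hopf axioms reduce to pointwise group laws.
theorem evalPair_ext {s t : S ⊗[k] S} (h : ∀ p, evalPair S p s = evalPair S p t) : s = t :=
  tensor_eq_of_characters (evalChar S) (evalChar S) (evalChar_separating S)
    (evalChar_separating S) fun i j => h (i, j)

theorem evalPair_injective : Function.Injective (AlgHom.pi (evalPair S)) :=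
  fun _ _ h => evalPair_ext fun p => congrFun h p

variable [Group F] (hΔ : ∀ f ∈ S, (fun p : F × F => f (p.1 * p.2)) ∈
    (AlgHom.pi (evalPair S)).range)
  (hS : ∀ f ∈ S, (fun g => f g⁻¹) ∈ S)

/-- The comultiplication on an algebra of functions on a group. -/
def functionComul : S →ₐ[k] S ⊗[k] S :=
  (AlgEquiv.ofInjective _ (evalPair_injective S)).symm.toAlgHom.comp
    ((AlgHom.pi fun p : F × F => evalChar S (p.1 * p.2)).codRestrict _
      fun f => hΔ f f.2)

theorem evalPair_functionComul (p : F × F) (f : S) :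
    evalPair S p (functionComul S hΔ f) = f.1 (p.1 * p.2) :=
  congrFun (congrArg Subtype.val
    ((AlgEquiv.ofInjective _ (evalPair_injective S)).apply_symm_apply
      ((AlgHom.pi fun p : F × F => evalChar S (p.1 * p.2)).codRestrict _
        (fun f => hΔ f f.2) f))) p

/-- The bialgebra structure on an algebra of functions on a group. -/
@[reducible]
def functionBialgebra : Bialgebra k S :=
  Bialgebra.ofAlgHom (functionComul S hΔ) (evalChar S 1)
    (by
      refine AlgHom.ext fun f => ?_
      -- Triples of points separate the triple tensor product, so coassociativity becomes
      -- associativity in `F`.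
      refine tensor_eq_of_characters (A := S) (B := S ⊗[k] S) (evalChar S) (evalPair S)
        (evalChar_separating S) (fun t ht => evalPair_ext fun p => ?_) fun g p => ?_
      · rw [ht p, map_zero]
      · have h1 : (Algebra.TensorProduct.lift (evalChar S g) (evalPair S p)
            fun _ _ => Commute.all _ _).comp
              ((Algebra.TensorProduct.assoc k k k S S S).toAlgHom.comp
                (Algebra.TensorProduct.map (functionComul S hΔ) (.id k S))) =
            evalPair S (g * p.1, p.2) := by
          have h2 : (Algebra.TensorProduct.lift (evalChar S g) (evalPair S p)
              fun _ _ => Commute.all _ _).comp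
                (Algebra.TensorProduct.assoc k k k S S S).toAlgHom =
              Algebra.TensorProduct.lift (evalPair S (g, p.1)) (evalChar S p.2)
                fun _ _ => Commute.all _ _ := by
            ext <;> simp [evalPair, Algebra.TensorProduct.one_def]
          rw [← AlgHom.comp_assoc, h2]
          ext x
          · simp [evalPair_functionComul]
          · simp
        have h3 : (Algebra.TensorProduct.lift (evalChar S g) (evalPair S p)
            fun _ _ => Commute.all _ _).comp
              (Algebra.TensorProduct.map (.id k S) (functionComul S hΔ)) =
            evalPair S (g, p.1 * p.2) := by
          ext x
          · simp
          · simp [evalPair_functionComul]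
        refine (AlgHom.congr_fun h1 (functionComul S hΔ f)).trans
          (Eq.trans ?_ (AlgHom.congr_fun h3 (functionComul S hΔ f)).symm)
        rw [evalPair_functionComul, evalPair_functionComul, mul_assoc])
    (by
      refine AlgHom.ext fun f => (Algebra.TensorProduct.lid k S).injective
        (Subtype.ext (funext fun g => ?_))
      have h : (evalChar S g).comp ((Algebra.TensorProduct.lid k S).toAlgHom.comp
          (Algebra.TensorProduct.map (evalChar S 1) (.id k S))) = evalPair S (1, g) := by
        ext x <;> simp
      refine (AlgHom.congr_fun h (functionComul S hΔ f)).trans ?_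
      rw [evalPair_functionComul, one_mul]
      simp)
    (by
      refine AlgHom.ext fun f => (Algebra.TensorProduct.rid k k S).injective
        (Subtype.ext (funext fun g => ?_))
      have h : (evalChar S g).comp ((Algebra.TensorProduct.rid k k S).toAlgHom.comp
          (Algebra.TensorProduct.map (.id k S) (evalChar S 1))) = evalPair S (g, 1) := by
        ext x <;> simp
      refine (AlgHom.congr_fun h (functionComul S hΔ f)).trans ?_
      rw [evalPair_functionComul, mul_one]
      simp)

/-- The antipode on an algebra of functions on a group. -/
def functionAntipode : S →ₐ[k] S :=
  (AlgHom.pi fun g => evalChar S g⁻¹).codRestrict S fun f => hS f f.2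

theorem functionAntipode_apply (f : S) (g : F) : (functionAntipode S hS f).1 g = f.1 g⁻¹ := rfl

/-- The Hopf algebra structure on an algebra of functions on a group. -/
@[reducible]
def functionHopfAlgebra : HopfAlgebra k S :=
  letI := functionBialgebra S hΔ
  HopfAlgebra.ofAlgHom (functionAntipode S hS)
    (by
      refine AlgHom.ext fun f => Subtype.ext (funext fun g => ?_)
      have h : (evalChar S g).comp (Algebra.TensorProduct.lift (functionAntipode S hS) (.id k S)
          fun _ _ => Commute.all _ _) = evalPair S (g⁻¹, g) := by
        ext x
        · simp [functionAntipode_apply]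
        · simp
      refine (AlgHom.congr_fun h (functionComul S hΔ f)).trans ?_
      rw [evalPair_functionComul, inv_mul_cancel]
      rfl)
    (by
      refine AlgHom.ext fun f => Subtype.ext (funext fun g => ?_)
      have h : (evalChar S g).comp (Algebra.TensorProduct.lift (.id k S) (functionAntipode S hS)
          fun _ _ => Commute.all _ _) = evalPair S (g, g⁻¹) := by
        ext x
        · simp
        · simp [functionAntipode_apply]
      refine (AlgHom.congr_fun h (functionComul S hΔ f)).trans ?_
      rw [evalPair_functionComul, mul_inv_cancel]
      rfl)

end Functions

/-! ### The coefficient algebra of a free group -/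

section FreeGroup

variable (k X : Type*) [Field k]

variable {X} in
open Classical in
/-- The endomorphism of a free group killing the generators outside a finite set. -/
def truncate (Y : Finset X) : FreeGroup X →* FreeGroup X :=
  FreeGroup.lift fun x => if x ∈ Y then FreeGroup.of x else 1

variable {X} in
theorem truncate_of_mem {Y : Finset X} {x : X} (h : x ∈ Y) :
    truncate Y (FreeGroup.of x) = FreeGroup.of x := by
  simp [truncate, h]

variable {X} in
theorem truncate_of_notMem {Y : Finset X} {x : X} (h : x ∉ Y) :
    truncate Y (FreeGroup.of x) = 1 := by
  simp [truncate, h]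

variable {X} in
theorem truncate_truncate {Y Z : Finset X} (h : Y ⊆ Z) (g : FreeGroup X) :
    truncate Y (truncate Z g) = truncate Y g := by
  refine DFunLike.congr_fun (FreeGroup.ext_hom ((truncate Y).comp (truncate Z)) (truncate Y)
    fun x => ?_) g
  by_cases hx : x ∈ Z
  · rw [MonoidHom.comp_apply, truncate_of_mem hx]
  · rw [MonoidHom.comp_apply, truncate_of_notMem hx, map_one,
      truncate_of_notMem fun hY => hx (h hY)]

/-- The matrix coefficients of the finite dimensional representations of a free group in which all
but finitely many generators act trivially. -/
def matrixCoefficients : Set (FreeGroup X → k) :=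
  {f | ∃ (n : ℕ) (ρ : FreeGroup X →* Matrix (Fin n) (Fin n) k) (Y : Finset X) (i j : Fin n),
    (∀ x ∉ Y, ρ (FreeGroup.of x) = 1) ∧ f = fun g => ρ g i j}

/-- The algebra generated by the matrix coefficients. -/
def coefficientAlgebra : Subalgebra k (FreeGroup X → k) :=
  Algebra.adjoin k (matrixCoefficients k X)

theorem comul_mem_range_of_mem_coefficientAlgebra : ∀ f ∈ coefficientAlgebra k X,
    (fun p : FreeGroup X × FreeGroup X => f (p.1 * p.2)) ∈
      (AlgHom.pi (evalPair (coefficientAlgebra k X))).range := by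
  let m : (FreeGroup X → k) →ₐ[k] (FreeGroup X × FreeGroup X → k) :=
    AlgHom.pi fun p => Pi.evalAlgHom k (fun _ => k) (p.1 * p.2)
  have hle : coefficientAlgebra k X ≤
      (AlgHom.pi (evalPair (coefficientAlgebra k X))).range.comap m := by
    refine Algebra.adjoin_le ?_
    rintro _ ⟨n, ρ, Y, i, j, hρ, rfl⟩
    have hmem (i j) : (fun g => ρ g i j) ∈ coefficientAlgebra k X :=
      Algebra.subset_adjoin ⟨n, ρ, Y, i, j, hρ, rfl⟩
    refine ⟨∑ l, ⟨_, hmem i l⟩ ⊗ₜ ⟨_, hmem l j⟩, ?_⟩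
    funext p
    change evalPair (coefficientAlgebra k X) p _ = ρ (p.1 * p.2) i j
    rw [map_sum, map_mul, Matrix.mul_apply]
    rfl
  exact fun f hf => hle hf

theorem inv_mem_coefficientAlgebra : ∀ f ∈ coefficientAlgebra k X,
    (fun g => f g⁻¹) ∈ coefficientAlgebra k X := by
  let m : (FreeGroup X → k) →ₐ[k] (FreeGroup X → k) :=
    AlgHom.pi fun g => Pi.evalAlgHom k (fun _ => k) g⁻¹
  have hle : coefficientAlgebra k X ≤ (coefficientAlgebra k X).comap m := by
    refine Algebra.adjoin_le ?_
    rintro _ ⟨n, ρ, Y, i, j, hρ, rfl⟩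
    -- The contragredient representation; its transpose swaps the indices `i` and `j`.
    let ρ' : FreeGroup X →* Matrix (Fin n) (Fin n) k :=
      { toFun := fun g => (ρ g⁻¹).transpose
        map_one' := by simp
        map_mul' := fun g h => by simp }
    refine Algebra.subset_adjoin ⟨n, ρ', Y, j, i, fun x hx => ?_, rfl⟩
    change (ρ (FreeGroup.of x)⁻¹).transpose = 1
    have h : ρ (FreeGroup.of x)⁻¹ = 1 := by
      have h1 : ρ (FreeGroup.of x)⁻¹ * ρ (FreeGroup.of x) = 1 := by
        rw [← map_mul, inv_mul_cancel, map_one]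
      rwa [hρ x hx, mul_one] at h1
    rw [h, Matrix.transpose_one]
  exact fun f hf => hle hf

instance : HopfAlgebra k (coefficientAlgebra k X) :=
  functionHopfAlgebra _ (comul_mem_range_of_mem_coefficientAlgebra k X)
    (inv_mem_coefficientAlgebra k X)

variable {k X}

theorem evalPair_comul_coefficientAlgebra (f : coefficientAlgebra k X)
    (p : FreeGroup X × FreeGroup X) :
    evalPair (coefficientAlgebra k X) p (comul f) = f.1 (p.1 * p.2) :=
  evalPair_functionComul _ (comul_mem_range_of_mem_coefficientAlgebra k X) p f

theorem counit_coefficientAlgebra (f : coefficientAlgebra k X) : counit (R := k) f = f.1 1 := rfl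

theorem toConv_evalChar_mul (g h : FreeGroup X) :
    WithConv.toConv (evalChar (coefficientAlgebra k X) (g * h)) =
      WithConv.toConv (evalChar (coefficientAlgebra k X) g) *
        WithConv.toConv (evalChar (coefficientAlgebra k X) h) := by
  apply WithConv.ofConv_injective
  refine AlgHom.ext fun f => ?_
  exact (evalPair_comul_coefficientAlgebra f (g, h)).symm.trans (AlgHom.convMul_apply _ _ f).symm

/-- A homomorphism from a free group to the group of characters of a Hopf algebra whose coefficient
functions lie in a Hopf algebra of functions defines a morphism of bialgebras. -/
def bialgHomOfCharacters {A : Type*} [CommRing A] [HopfAlgebra k A]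
    (ψ : FreeGroup X →* WithConv (A →ₐ[k] k))
    (hψ : ∀ a, (fun g => ψ g a) ∈ coefficientAlgebra k X) : A →ₐc[k] coefficientAlgebra k X :=
  BialgHom.ofAlgHom ((AlgHom.pi fun g => (ψ g).ofConv).codRestrict (coefficientAlgebra k X) hψ)
    (by
      refine AlgHom.ext fun a => ?_
      refine (counit_coefficientAlgebra _).trans ?_
      change ψ 1 a = _
      rw [map_one]
      exact AlgHom.convOne_apply a)
    (by
      refine AlgHom.ext fun a => evalPair_ext fun p => ?_
      rw [AlgHom.comp_apply (Bialgebra.comulAlgHom k (coefficientAlgebra k X))]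
      refine Eq.trans ?_ (evalPair_comul_coefficientAlgebra _ p).symm
      change _ = ψ (p.1 * p.2) a
      rw [map_mul]
      refine Eq.trans ?_ (AlgHom.convMul_apply _ _ a).symm
      have h : (evalPair (coefficientAlgebra k X) p).comp (Algebra.TensorProduct.map
          ((AlgHom.pi fun g => (ψ g).ofConv).codRestrict (coefficientAlgebra k X) hψ)
          ((AlgHom.pi fun g => (ψ g).ofConv).codRestrict (coefficientAlgebra k X) hψ)) =
          Algebra.TensorProduct.lift (ψ p.1).ofConv (ψ p.2).ofConv fun _ _ => Commute.all _ _ := by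
        ext x
        · simp
          rfl
        · simp
          rfl
      exact AlgHom.congr_fun h _)

omit [Field k] in
theorem truncate_apply_of_subset {f : FreeGroup X → k} {Y Z : Finset X} (hYZ : Y ⊆ Z)
    (hf : ∀ g, f (truncate Y g) = f g) (g : FreeGroup X) : f (truncate Z g) = f g := by
  rw [← hf, truncate_truncate hYZ, hf]

/-- Every element of the coefficient algebra depends on finitely many generators only. -/
theorem exists_truncate_apply_eq (f : coefficientAlgebra k X) :
    ∃ Y : Finset X, ∀ g, f.1 (truncate Y g) = f.1 g := by
  classical
  obtain ⟨f, hf⟩ := f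
  induction hf using Algebra.adjoin_induction with
  | mem f hf =>
    obtain ⟨n, ρ, Y, i, j, hρ, rfl⟩ := hf
    refine ⟨Y, fun g => ?_⟩
    have h : ρ.comp (truncate Y) = ρ := FreeGroup.ext_hom _ _ fun x => by
      by_cases hx : x ∈ Y
      · rw [MonoidHom.comp_apply, truncate_of_mem hx]
      · rw [MonoidHom.comp_apply, truncate_of_notMem hx, map_one, hρ x hx]
    exact congrFun (congrFun (DFunLike.congr_fun h g) i) j
  | algebraMap c => exact ⟨∅, fun g => rfl⟩
  | add f f' _ _ hf hf' =>
    obtain ⟨Y, hY⟩ := hf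
    obtain ⟨Z, hZ⟩ := hf'
    exact ⟨Y ∪ Z, fun g => congrArg₂ (· + ·)
      (truncate_apply_of_subset Finset.subset_union_left hY g)
      (truncate_apply_of_subset Finset.subset_union_right hZ g)⟩
  | mul f f' _ _ hf hf' =>
    obtain ⟨Y, hY⟩ := hf
    obtain ⟨Z, hZ⟩ := hf'
    exact ⟨Y ∪ Z, fun g => congrArg₂ (· * ·)
      (truncate_apply_of_subset Finset.subset_union_left hY g)
      (truncate_apply_of_subset Finset.subset_union_right hZ g)⟩

/-- The coefficient functions of a family of characters converging to the counit lie in the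
coefficient algebra. -/
theorem coefficient_mem_coefficientAlgebra {A : Type*} [CommRing A] [HopfAlgebra k A]
    (χ : X → WithConv (A →ₐ[k] k)) (hχ : ∀ a, {x | χ x a ≠ counit (R := k) a}.Finite) (a : A) :
    (fun g => FreeGroup.lift χ g a) ∈ coefficientAlgebra k X := by
  classical
  obtain ⟨n, b, M, ha, hb, hΔ, hε⟩ := exists_comatrix (k := k) a
  -- Characters applied to a comatrix give a representation. Outside the union `Y` of the
  -- exceptional sets of its finitely many entries, the generators act trivially.
  let ρ : FreeGroup X →* Matrix (Fin n) (Fin n) k :=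
    { toFun := fun g => Matrix.of fun i j => FreeGroup.lift χ g (M i j)
      map_one' := by
        ext i j
        rw [Matrix.of_apply, map_one, AlgHom.convOne_apply, hε, Matrix.one_apply]
        rfl
      map_mul' := fun g h => by
        ext i j
        rw [Matrix.of_apply, map_mul, AlgHom.convMul_apply, hΔ, map_sum, Matrix.mul_apply]
        rfl }
  let Y : Finset X := Finset.univ.biUnion fun p : Fin n × Fin n => (hχ (M p.1 p.2)).toFinset
  have hρ (x) (hx : x ∉ Y) : ρ (FreeGroup.of x) = 1 := by
    ext i j
    change FreeGroup.lift χ (FreeGroup.of x) (M i j) = _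
    rw [FreeGroup.lift_apply_of, Matrix.one_apply, ← hε]
    by_contra h
    exact hx (Finset.mem_biUnion.mpr ⟨(i, j), Finset.mem_univ _, (hχ _).mem_toFinset.mpr h⟩)
  have hM (i j) : (fun g => FreeGroup.lift χ g (M i j)) ∈ coefficientAlgebra k X :=
    Algebra.subset_adjoin ⟨n, ρ, Y, i, j, hρ, rfl⟩
  let q : A →ₐ[k] (FreeGroup X → k) := AlgHom.pi fun g => (FreeGroup.lift χ g).ofConv
  have hle : Submodule.span k (Set.range b) ≤
      (Subalgebra.toSubmodule (coefficientAlgebra k X)).comap q.toLinearMap := by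
    rw [Submodule.span_le]
    rintro _ ⟨i, rfl⟩
    change q (b i) ∈ coefficientAlgebra k X
    have h := contractLeft_counit (k := k) (b i)
    rw [hb, map_sum] at h
    rw [← h, map_sum]
    refine sum_mem fun j _ => ?_
    rw [contractLeft_tmul, map_smul]
    exact Subalgebra.smul_mem _ (hM j i) _
  exact hle ha

end FreeGroup

end HopfAlgebra

/-! ### The free proalgebraic group -/

namespace ProalgebraicGroup

open WithConv HopfAlgebra

local notation "𝕂" => LiftedComplex

section Iso

variable {G H : ProalgebraicGroup.{u}}

theorem mapPoints_hom_inv (e : G ≅ H) (p : G.Points) :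
    mapPoints e.inv (mapPoints e.hom p) = p := by
  rw [← mapPoints_comp, e.hom_inv_id, mapPoints_id]

theorem mapPoints_inv_hom (e : G ≅ H) (p : H.Points) :
    mapPoints e.hom (mapPoints e.inv p) = p := by
  rw [← mapPoints_comp, e.inv_hom_id, mapPoints_id]

theorem IsQuotientMap.iso_comp {K : ProalgebraicGroup.{u}} (e : G ≅ H) {f : H ⟶ K}
    (hf : IsQuotientMap f) : IsQuotientMap (e.hom ≫ f) := by
  have h1 : (Hom.toOver e.hom).left ≫ (Hom.toOver e.inv).left = 𝟙 _ :=
    congrArg (fun k => (Hom.toOver k).left) e.hom_inv_id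
  have h2 : (Hom.toOver e.inv).left ≫ (Hom.toOver e.hom).left = 𝟙 _ :=
    congrArg (fun k => (Hom.toOver k).left) e.inv_hom_id
  have : IsIso (Hom.toOver e.hom).left := ⟨_, h1, h2⟩
  have := hf.1
  have := hf.2
  constructor
  · change Flat ((Hom.toOver e.hom).left ≫ (Hom.toOver f).left)
    infer_instance
  · change Surjective ((Hom.toOver e.hom).left ≫ (Hom.toOver f).left)
    infer_instance

theorem ConvergesToOne.map_iso {X : Type u} {φ : X → G.Points} (hφ : ConvergesToOne φ)
    (e : G ≅ H) : ConvergesToOne fun x => mapPoints e.hom (φ x) := by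
  intro K f hK hf
  have := hφ K (e.hom ≫ f) hK (hf.iso_comp e)
  simpa only [mapPoints_comp] using this

theorem IsFreeOn.map_iso {X : Type u} {ι : X → G.Points} (hι : IsFreeOn ι) (e : G ≅ H) :
    IsFreeOn fun x => mapPoints e.hom (ι x) where
  convergesToOne := hι.convergesToOne.map_iso e
  existsUnique_hom K φ hφ := by
    obtain ⟨f, hf, huniq⟩ := hι.existsUnique_hom K φ hφ
    refine ⟨e.inv ≫ f, fun x => ?_, fun g hg => ?_⟩
    · rw [mapPoints_comp, mapPoints_hom_inv]
      exact hf x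
    · rw [Iso.eq_inv_comp]
      refine huniq _ fun x => ?_
      rw [mapPoints_comp]
      exact hg x

theorem IsFreeOn.hom_ext {X : Type u} {ι : X → G.Points} (hι : IsFreeOn ι) {f g : G ⟶ H}
    (hf : ConvergesToOne fun x => mapPoints f (ι x))
    (h : ∀ x, mapPoints f (ι x) = mapPoints g (ι x)) : f = g :=
  (hι.existsUnique_hom H _ hf).unique (fun _ => rfl) fun x => (h x).symm

theorem convergesToOne_of_finite_support {X : Type u} {φ : X → G.Points}
    (h : {x | φ x ≠ 1}.Finite) : ConvergesToOne φ := by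
  refine fun K f _ _ => h.subset fun x hx h1 => hx ?_
  rw [h1, mapPoints_one]

theorem convergesToOne_extendByOne {X : Type u} (Y : Finset X) (ι : Y → G.Points) :
    ConvergesToOne (extendByOne Y ι) := by
  refine convergesToOne_of_finite_support (Y.finite_toSet.subset fun x hx => ?_)
  by_contra hxY
  exact hx (dif_neg hxY)

/-- The isomorphism between two free proalgebraic groups on the same set. -/
theorem IsFreeOn.exists_iso {X : Type u} {ι : X → G.Points} {κ : X → H.Points}
    (hι : IsFreeOn ι) (hκ : IsFreeOn κ) : ∃ e : G ≅ H, ∀ x, mapPoints e.hom (ι x) = κ x := by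
  refine ⟨⟨hι.lift κ hκ.convergesToOne, hκ.lift ι hι.convergesToOne,
    hι.hom_ext ?_ fun x => ?_, hκ.hom_ext ?_ fun x => ?_⟩, hι.lift_spec κ hκ.convergesToOne⟩
  · simpa only [mapPoints_comp, lift_spec] using hι.convergesToOne
  · rw [mapPoints_comp, lift_spec, lift_spec, mapPoints_id]
  · simpa only [mapPoints_comp, lift_spec] using hκ.convergesToOne
  · rw [mapPoints_comp, lift_spec, lift_spec, mapPoints_id]

end Iso

section FreeGroup

variable (X : Type u)

/-- The free proalgebraic group on a set. -/
abbrev freeProalgebraicGroup : ProalgebraicGroup.{u} := specGroup (coefficientAlgebra 𝕂 X)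

variable {X}

/-- The generators of the free proalgebraic group. -/
def generator (x : X) : (freeProalgebraicGroup X).Points :=
  pointsEquiv (coefficientAlgebra 𝕂 X)
    (toConv (evalChar (coefficientAlgebra 𝕂 X) (FreeGroup.of x)))

theorem mapPoints_specMap_eq_one_iff {A B : Type u} [CommRing A] [HopfAlgebra 𝕂 A] [CommRing B]
    [HopfAlgebra 𝕂 B] (f : B →ₐc[𝕂] A) (χ : WithConv (A →ₐ[𝕂] 𝕂)) :
    mapPoints (specMap f) (pointsEquiv A χ) = 1 ↔
      ∀ b, χ (f b) = Coalgebra.counit (R := 𝕂) b := by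
  rw [mapPoints_specMap, ← map_one (pointsEquiv B), (pointsEquiv B).injective.eq_iff,
    WithConv.ext_iff]
  refine AlgHom.ext_iff.trans (forall_congr' fun b => ?_)
  exact Iff.rfl

/-- The character of `A` obtained by evaluating at a point of the free group. -/
def characterAt {A : Type u} [CommRing A] [HopfAlgebra 𝕂 A]
    (f : A →ₐc[𝕂] coefficientAlgebra 𝕂 X) (w : FreeGroup X) : A →ₐ[𝕂] 𝕂 :=
  (evalChar (coefficientAlgebra 𝕂 X) w).comp (f : A →ₐ[𝕂] coefficientAlgebra 𝕂 X)

theorem mapPoints_specMap_generator {A : Type u} [CommRing A] [HopfAlgebra 𝕂 A]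
    (f : A →ₐc[𝕂] coefficientAlgebra 𝕂 X) (x : X) :
    mapPoints (specMap f) (generator x) = pointsEquiv A (toConv (characterAt f (FreeGroup.of x))) :=
  mapPoints_specMap f _

/-- The coordinate ring of an algebraic `H` has finitely many generators, whose images depend on
finitely many elements of `X`; every other `x` evaluates them as the identity does. -/
theorem convergesToOne_generator : ConvergesToOne (generator (X := X)) := by
  classical
  intro H f hH _
  obtain ⟨B, _, _, ⟨e⟩⟩ := exists_iso_specGroup H
  obtain ⟨u, hu⟩ := exists_specMap_eq (A := coefficientAlgebra 𝕂 X) (f ≫ e.inv)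
  have hB : Algebra.FiniteType 𝕂 B := by
    rw [← isAlgebraic_specGroup_iff]
    have hw : (Hom.toOver e.hom).left ≫ H.obj.X.hom = (specGroup B).obj.X.hom :=
      Over.w (Hom.toOver e.hom)
    have h1 : (Hom.toOver e.hom).left ≫ (Hom.toOver e.inv).left = 𝟙 _ :=
      congrArg (fun k => (Hom.toOver k).left) e.hom_inv_id
    have h2 : (Hom.toOver e.inv).left ≫ (Hom.toOver e.hom).left = 𝟙 _ :=
      congrArg (fun k => (Hom.toOver k).left) e.inv_hom_id
    have : IsIso (Hom.toOver e.hom).left := ⟨_, h1, h2⟩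
    have : LocallyOfFiniteType H.obj.X.hom := hH
    rw [IsAlgebraic, ← hw]
    infer_instance
  obtain ⟨s, hs⟩ := hB.out
  choose Y hY using fun b : B => exists_truncate_apply_eq (u b)
  refine (s.biUnion Y).finite_toSet.subset fun x hx => ?_
  by_contra hxY
  refine hx ?_
  have h : mapPoints (specMap u) (generator x) = 1 := by
    rw [generator, mapPoints_specMap_eq_one_iff]
    refine AlgHom.congr_fun (φ₁ := characterAt u (FreeGroup.of x))
      (φ₂ := Bialgebra.counitAlgHom 𝕂 B) (AlgHom.ext_of_adjoin_eq_top hs fun b hb => ?_)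
    have h1 : x ∉ Y b := fun h => hxY (Finset.mem_biUnion.mpr ⟨b, hb, h⟩)
    change (u b).1 (FreeGroup.of x) = Coalgebra.counit b
    rw [← hY, truncate_of_notMem h1, ← counit_coefficientAlgebra]
    exact CoalgHomClass.counit_comp_apply u b
  rw [hu, mapPoints_comp] at h
  rw [← mapPoints_inv_hom e (mapPoints f _), h, mapPoints_one]

/-- Faithful flatness enters here: `a` lies in a finitely generated Hopf subalgebra, whose inclusion
is a quotient map onto an algebraic group, so convergence applies to it. -/
theorem finite_setOf_ne_counit {A : Type u} [CommRing A] [HopfAlgebra 𝕂 A]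
    {χ : X → WithConv (A →ₐ[𝕂] 𝕂)} (hχ : ConvergesToOne fun x => pointsEquiv A (χ x)) (a : A) :
    {x | χ x a ≠ Coalgebra.counit (R := 𝕂) a}.Finite := by
  obtain ⟨B, _, _, f, b, hB, hf, rfl⟩ := exists_finiteType_bialgHom (k := 𝕂) a
  refine (hχ (specGroup B) (specMap f) (isAlgebraic_specGroup_iff.mpr hB)
    (isQuotientMap_specMap f (faithfullyFlat_of_injective f hf))).subset fun x hx h => hx ?_
  rw [mapPoints_specMap_eq_one_iff] at h
  exact (h b).trans (CoalgHomClass.counit_comp_apply f b).symm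

/-- Evaluating a bialgebra morphism at words gives a homomorphism from the free group to the
characters of `A`, determined by the generators. -/
theorem bialgHom_coefficientAlgebra_ext {A : Type u} [CommRing A] [HopfAlgebra 𝕂 A]
    {f g : A →ₐc[𝕂] coefficientAlgebra 𝕂 X}
    (h : ∀ x a, (f a).1 (FreeGroup.of x) = (g a).1 (FreeGroup.of x)) : f = g := by
  let F (f : A →ₐc[𝕂] coefficientAlgebra 𝕂 X) : FreeGroup X →* WithConv (A →ₐ[𝕂] 𝕂) :=
    MonoidHom.mk' (fun w => toConv (characterAt f w)) fun v w => by
      have := congrArg (fun χ => toConv (χ.ofConv.comp (f : A →ₐ[𝕂] coefficientAlgebra 𝕂 X)))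
        (toConv_evalChar_mul (k := 𝕂) v w)
      rw [AlgHom.convMul_comp_bialgHom_distrib] at this
      exact this
  have hF : F f = F g := FreeGroup.ext_hom _ _ fun x =>
    WithConv.ofConv_injective (AlgHom.ext (h x))
  refine DFunLike.ext _ _ fun a => Subtype.ext (funext fun w => ?_)
  exact congrArg (fun χ => χ.ofConv a) (DFunLike.congr_fun hF w)

theorem isFreeOn_generator : IsFreeOn (generator (X := X)) where
  convergesToOne := convergesToOne_generator
  existsUnique_hom H φ hφ := by
    obtain ⟨A, _, _, ⟨e⟩⟩ := exists_iso_specGroup H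
    let χ (x : X) : WithConv (A →ₐ[𝕂] 𝕂) := (pointsEquiv A).symm (mapPoints e.inv (φ x))
    have hχφ (x) : pointsEquiv A (χ x) = mapPoints e.inv (φ x) := MulEquiv.apply_symm_apply _ _
    have hχ : ConvergesToOne fun x => pointsEquiv A (χ x) := by
      simp only [hχφ]
      exact hφ.map_iso e.symm
    let u : A →ₐc[𝕂] coefficientAlgebra 𝕂 X := bialgHomOfCharacters (FreeGroup.lift χ)
      (coefficient_mem_coefficientAlgebra χ (finite_setOf_ne_counit hχ))
    have hu (x) : toConv (characterAt u (FreeGroup.of x)) = χ x := by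
      apply WithConv.ofConv_injective
      refine AlgHom.ext fun a => ?_
      change FreeGroup.lift χ (FreeGroup.of x) a = χ x a
      rw [FreeGroup.lift_apply_of]
    refine ⟨specMap u ≫ e.hom, fun x => ?_, fun f hf => ?_⟩
    · rw [mapPoints_comp, mapPoints_specMap_generator, hu, hχφ, mapPoints_inv_hom]
    · obtain ⟨v, hv⟩ := exists_specMap_eq (A := coefficientAlgebra 𝕂 X) (f ≫ e.inv)
      rw [← Iso.comp_inv_eq]
      refine hv.symm.trans (congrArg specMap ?_)
      refine bialgHom_coefficientAlgebra_ext fun x => AlgHom.congr_fun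
        (φ₁ := characterAt v (FreeGroup.of x))
        (φ₂ := characterAt u (FreeGroup.of x)) ?_
      refine congrArg ofConv (Eq.trans ?_ (hu x).symm)
      apply (pointsEquiv A).injective
      rw [hχφ, ← hf, ← mapPoints_comp]
      rw [← hv, mapPoints_specMap_generator]
      rfl

end FreeGroup

end ProalgebraicGroup

/-! ### Truncations and gluing of compatible morphisms -/

namespace HopfAlgebra

open TensorProduct Coalgebra

variable {k X : Type*} [Field k]

theorem comp_truncate_mem_coefficientAlgebra (Y : Finset X) : ∀ f ∈ coefficientAlgebra k X,
    (fun g => f (truncate Y g)) ∈ coefficientAlgebra k X := by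
  let m : (FreeGroup X → k) →ₐ[k] (FreeGroup X → k) :=
    AlgHom.pi fun g => Pi.evalAlgHom k (fun _ => k) (truncate Y g)
  have hle : coefficientAlgebra k X ≤ (coefficientAlgebra k X).comap m := by
    refine Algebra.adjoin_le ?_
    rintro _ ⟨n, ρ, Z, i, j, hρ, rfl⟩
    refine Algebra.subset_adjoin ⟨n, ρ.comp (truncate Y), Y, i, j, fun x hx => ?_, rfl⟩
    rw [MonoidHom.comp_apply, truncate_of_notMem hx, map_one]
  exact fun f hf => hle hf

/-- The endomorphism of the coefficient algebra induced by `truncate Y`. -/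
def truncateHom (Y : Finset X) : coefficientAlgebra k X →ₐc[k] coefficientAlgebra k X :=
  bialgHomOfCharacters
    (MonoidHom.mk' (fun g => WithConv.toConv (evalChar (coefficientAlgebra k X) (truncate Y g)))
      fun g h => by rw [map_mul, toConv_evalChar_mul])
    fun f => comp_truncate_mem_coefficientAlgebra Y f.1 f.2

theorem exists_truncateHom_eq (f : coefficientAlgebra k X) :
    ∃ Y : Finset X, ∀ Z, Y ⊆ Z → truncateHom Z f = f := by
  obtain ⟨Y, hY⟩ := exists_truncate_apply_eq f
  exact ⟨Y, fun Z hYZ => Subtype.ext (funext (truncate_apply_of_subset hYZ hY))⟩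

/-- A bialgebra is the colimit of the images of a directed family of endomorphisms which are
eventually the identity on every element. -/
theorem existsUnique_comp_of_eventually_eq {S B : Type*} [CommRing S] [Bialgebra k S] [CommRing B]
    [Bialgebra k B] (τ : Finset X → (S →ₐc[k] S))
    (hτ : ∀ f, ∃ Y : Finset X, ∀ Z, Y ⊆ Z → τ Z f = f)
    (u : Finset X → (S →ₐc[k] B))
    (hu : ∀ Y Z, Y ⊆ Z → (u Z).comp (τ Y) = u Y) :
    ∃! m : S →ₐc[k] B, ∀ Y, m.comp (τ Y) = u Y := by
  classical
  choose Y hY using hτ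
  -- The value `u Z f` stabilises once `Z` contains `Y f`; the stable value defines the glued map,
  -- and each identity is checked at a large enough `Z`.
  have hu' (f) (Z) (h : Y f ⊆ Z) : u Z f = u (Y f) f := by
    rw [← hu _ _ h, BialgHom.comp_apply, hY _ _ subset_rfl]
  let m₀ : S →ₐ[k] B :=
    { toFun f := u (Y f) f
      map_one' := map_one _
      map_zero' := map_zero _
      commutes' := fun c => AlgHomClass.commutes _ c
      map_mul' := fun a b => by
        have h1 := hu' a (Y a ∪ (Y b ∪ Y (a * b))) (by grind)
        have h2 := hu' b (Y a ∪ (Y b ∪ Y (a * b))) (by grind)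
        have h3 := hu' (a * b) (Y a ∪ (Y b ∪ Y (a * b))) (by grind)
        rw [← h1, ← h2, ← h3, map_mul]
      map_add' := fun a b => by
        have h1 := hu' a (Y a ∪ (Y b ∪ Y (a + b))) (by grind)
        have h2 := hu' b (Y a ∪ (Y b ∪ Y (a + b))) (by grind)
        have h3 := hu' (a + b) (Y a ∪ (Y b ∪ Y (a + b))) (by grind)
        rw [← h1, ← h2, ← h3, map_add] }
  have hm (f) (Z) (h : Y f ⊆ Z) : m₀ f = u Z f := (hu' f Z h).symm
  -- Stabilisation for tensors, which are finite sums; needed for compatibility with the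
  -- comultiplication.
  have hm2 (t : S ⊗[k] S) : ∃ W, ∀ Z, W ⊆ Z →
      Algebra.TensorProduct.map m₀ m₀ t =
        Algebra.TensorProduct.map (u Z : S →ₐ[k] B) (u Z) t := by
    induction t with
    | zero => exact ⟨∅, fun Z _ => by rw [map_zero, map_zero]⟩
    | add s t hs ht =>
      obtain ⟨V, hV⟩ := hs
      obtain ⟨W, hW⟩ := ht
      refine ⟨V ∪ W, fun Z hZ => ?_⟩
      rw [map_add, map_add, hV Z (by grind), hW Z (by grind)]
    | tmul a b =>
      refine ⟨Y a ∪ Y b, fun Z hZ => ?_⟩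
      rw [Algebra.TensorProduct.map_tmul, Algebra.TensorProduct.map_tmul,
        hm a Z (by grind), hm b Z (by grind)]
      rfl
  let m : S →ₐc[k] B := BialgHom.ofAlgHom m₀
    (AlgHom.ext fun f => CoalgHomClass.counit_comp_apply (u (Y f)) f)
    (AlgHom.ext fun f => by
      obtain ⟨W, hW⟩ := hm2 (comul f)
      refine (hW (W ∪ Y f) (by grind)).trans ?_
      refine (CoalgHomClass.map_comp_comul_apply (u (W ∪ Y f)) f).trans ?_
      exact congrArg comul (hm f (W ∪ Y f) (by grind)).symm)
  refine ⟨m, fun Z => ?_, fun m' hm' => ?_⟩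
  · refine DFunLike.ext _ _ fun f => ?_
    refine (hm (τ Z f) (Y (τ Z f) ∪ Z) (by grind)).trans ?_
    exact DFunLike.congr_fun (hu Z _ (by grind)) f
  · refine DFunLike.ext _ _ fun f => ?_
    refine Eq.trans ?_ (DFunLike.congr_fun (hm' (Y f)) f)
    rw [BialgHom.comp_apply, hY _ _ subset_rfl]

end HopfAlgebra

namespace ProalgebraicGroup

open HopfAlgebra

local notation "𝕂" => LiftedComplex

/-- The endomorphism of the free proalgebraic group killing the generators outside a finite set. -/
def truncation {X : Type u} (Y : Finset X) : freeProalgebraicGroup X ⟶ freeProalgebraicGroup X :=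
  specMap (truncateHom (k := LiftedComplex.{u}) Y)

theorem mapPoints_truncation {X : Type u} (Y : Finset X) (x : X) :
    mapPoints (truncation Y) (generator x) = extendByOne Y (fun y => generator y.1) x := by
  rw [extendByOne]
  split_ifs with hx
  · refine (mapPoints_specMap_generator _ x).trans ?_
    have h : characterAt (truncateHom (k := LiftedComplex.{u}) Y) (FreeGroup.of x) =
        evalChar (coefficientAlgebra 𝕂 X) (truncate Y (FreeGroup.of x)) := rfl
    rw [h, truncate_of_mem hx]
    rfl
  · rw [truncation, generator, mapPoints_specMap_eq_one_iff]
    intro f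
    change f.1 (truncate Y (FreeGroup.of x)) = f.1 1
    rw [truncate_of_notMem hx]

theorem existsUnique_comp_specMap_of_eventually_eq {X : Type*} {S : Type u} [CommRing S]
    [HopfAlgebra 𝕂 S] (τ : Finset X → (S →ₐc[𝕂] S))
    (hτ : ∀ f, ∃ Y : Finset X, ∀ Z, Y ⊆ Z → τ Z f = f) {T : ProalgebraicGroup.{u}}
    (g : Finset X → (T ⟶ specGroup S)) (hg : ∀ Y Z, Y ⊆ Z → g Z ≫ specMap (τ Y) = g Y) :
    ∃! m : T ⟶ specGroup S, ∀ Y, m ≫ specMap (τ Y) = g Y := by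
  obtain ⟨B, _, _, ⟨e⟩⟩ := exists_iso_specGroup T
  choose v hv using fun Y => exists_specMap_eq (e.hom ≫ g Y)
  obtain ⟨m, hm, huniq⟩ := existsUnique_comp_of_eventually_eq τ hτ v fun Y Z hYZ =>
    specMap_injective <| by rw [specMap_comp, hv, hv, Category.assoc, hg Y Z hYZ]
  refine ⟨e.inv ≫ specMap m, fun Y => ?_, fun m' hm' => ?_⟩
  · rw [Category.assoc, Iso.inv_comp_eq, ← hv, ← hm, specMap_comp]
  · obtain ⟨n, hn⟩ := exists_specMap_eq (e.hom ≫ m')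
    rw [Iso.eq_inv_comp, ← hn, huniq n fun Y => specMap_injective ?_]
    rw [specMap_comp, hn, hv, Category.assoc, hm']

theorem existsUnique_comp_truncation {X : Type u} {T : ProalgebraicGroup.{u}}
    (g : Finset X → (T ⟶ freeProalgebraicGroup X))
    (hg : ∀ Y Z, Y ⊆ Z → g Z ≫ truncation Y = g Y) :
    ∃! m : T ⟶ freeProalgebraicGroup X, ∀ Y, m ≫ truncation Y = g Y :=
  existsUnique_comp_specMap_of_eventually_eq (S := coefficientAlgebra 𝕂 X) truncateHom
    exists_truncateHom_eq g hg

end ProalgebraicGroup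

/-! ### The projective limit of the finite free groups -/

namespace ProalgebraicGroup

open Opposite

/-- Morphisms that agree on all points after composition with a jointly monic family agree. -/
theorem points_ext_of_isLimit {J : Type u} [Category.{u} J] {F : J ⥤ ProalgebraicGroup.{u}}
    {c : Cone F} (hc : IsLimit c) {p q : c.pt.Points}
    (h : ∀ i, mapPoints (c.π.app i) p = mapPoints (c.π.app i) q) : p = q := by
  -- Points are represented by the free group on one generator, so the limit property for morphisms
  -- applies to them.
  have hfree : IsFreeOn (generator (X := PUnit.{u + 1})) := isFreeOn_generator
  obtain ⟨f, hf, -⟩ := hfree.existsUnique_hom c.pt (fun _ => p) (convergesToOne_of_finite _)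
  obtain ⟨g, hg, -⟩ := hfree.existsUnique_hom c.pt (fun _ => q) (convergesToOne_of_finite _)
  have hfg : f = g := hc.hom_ext fun i =>
    hfree.hom_ext (convergesToOne_of_finite _) fun x => by
      rw [mapPoints_comp, mapPoints_comp, hf, hg, h]
  rw [← hf PUnit.unit, ← hg PUnit.unit, hfg]

theorem extendByOne_of_mem {X : Type u} {G : ProalgebraicGroup.{u}} {Y : Finset X}
    (ι : Y → G.Points) {x : X} (h : x ∈ Y) : extendByOne Y ι x = ι ⟨x, h⟩ := dif_pos h

theorem extendByOne_of_notMem {X : Type u} {G : ProalgebraicGroup.{u}} {Y : Finset X}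
    (ι : Y → G.Points) {x : X} (h : x ∉ Y) : extendByOne Y ι x = 1 := dif_neg h

theorem mapPoints_extendByOne {X : Type u} {G H : ProalgebraicGroup.{u}} {Y : Finset X}
    (f : G ⟶ H) (ι : Y → G.Points) (x : X) :
    mapPoints f (extendByOne Y ι x) = extendByOne Y (fun y => mapPoints f (ι y)) x := by
  by_cases h : x ∈ Y
  · rw [extendByOne_of_mem _ h, extendByOne_of_mem _ h]
  · rw [extendByOne_of_notMem _ h, extendByOne_of_notMem _ h, mapPoints_one]

section System

variable {X : Type u} (Γ : Finset X → ProalgebraicGroup.{u})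
  (ι : ∀ Y : Finset X, Y → (Γ Y).Points) (hfree : ∀ Y : Finset X, IsFreeOn (ι Y))

/-- The projection from the free proalgebraic group on `X` to the one on a finite subset. -/
def projection (Y : Finset X) : freeProalgebraicGroup X ⟶ Γ Y :=
  isFreeOn_generator.lift (extendByOne Y (ι Y)) (convergesToOne_extendByOne Y (ι Y))

theorem mapPoints_projection (Y : Finset X) (x : X) :
    mapPoints (projection Γ ι Y) (generator x) = extendByOne Y (ι Y) x :=
  isFreeOn_generator.lift_spec _ (convergesToOne_extendByOne Y (ι Y)) x

/-- The section of the projection to the free proalgebraic group on a finite subset. -/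
def inclusion (Y : Finset X) : Γ Y ⟶ freeProalgebraicGroup X :=
  (hfree Y).lift (fun y => generator y.1) (convergesToOne_of_finite _)

theorem mapPoints_inclusion (Y : Finset X) (y : Y) :
    mapPoints (inclusion Γ ι hfree Y) (ι Y y) = generator y.1 :=
  (hfree Y).lift_spec _ (convergesToOne_of_finite _) y

/-- With `inclusion_comp_projection` at `Z = Y`, this makes `Γ Y` the retract of the free group on
`X` cut out by truncation. -/
theorem projection_comp_inclusion (Y : Finset X) :
    projection Γ ι Y ≫ inclusion Γ ι hfree Y = truncation Y := by
  have h (x : X) : mapPoints (projection Γ ι Y ≫ inclusion Γ ι hfree Y) (generator x) =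
      extendByOne Y (fun y => generator y.1) x := by
    simp only [mapPoints_comp, mapPoints_projection, mapPoints_extendByOne, mapPoints_inclusion]
  refine isFreeOn_generator.hom_ext ?_ fun x => (h x).trans (mapPoints_truncation Y x).symm
  simp only [h]
  exact convergesToOne_extendByOne Y _

theorem inclusion_comp_projection (Y Z : Finset X) :
    inclusion Γ ι hfree Z ≫ projection Γ ι Y = transition Γ ι hfree Y Z :=
  (hfree Z).hom_ext (convergesToOne_of_finite _) fun z => by
    rw [mapPoints_comp, mapPoints_inclusion, mapPoints_projection, mapPoints_transition]

theorem transition_self (Y : Finset X) : transition Γ ι hfree Y Y = 𝟙 (Γ Y) :=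
  (freeSystem Γ ι hfree).map_id (op Y)

theorem projection_comp_transition {Y Z : Finset X} (h : Y ⊆ Z) :
    projection Γ ι Z ≫ transition Γ ι hfree Y Z = projection Γ ι Y := by
  have hx (x : X) : mapPoints (projection Γ ι Z ≫ transition Γ ι hfree Y Z) (generator x) =
      extendByOne Y (ι Y) x := by
    rw [mapPoints_comp, mapPoints_projection]
    by_cases hZ : x ∈ Z
    · rw [extendByOne_of_mem _ hZ, mapPoints_transition]
    · rw [extendByOne_of_notMem _ hZ, mapPoints_one, extendByOne_of_notMem _ fun hY => hZ (h hY)]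
  refine isFreeOn_generator.hom_ext ?_ fun x => (hx x).trans (mapPoints_projection Γ ι Y x).symm
  simp only [hx]
  exact convergesToOne_extendByOne Y _

/-- The free proalgebraic group on `X` as a cone over the system of the free proalgebraic groups on
the finite subsets. -/
def freeCone : Cone (freeSystem Γ ι hfree) where
  pt := freeProalgebraicGroup X
  π :=
    { app Y := projection Γ ι Y.unop
      naturality Z Y f := by
        refine (Category.id_comp _).trans ?_
        exact (projection_comp_transition Γ ι hfree (leOfHom f.unop)).symm }

/-- The inclusions are split monomorphisms, so prescribing `m` after projection is the same as
prescribing it after truncation, where gluing applies. -/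
theorem existsUnique_comp_projection {T : ProalgebraicGroup.{u}} (σ : ∀ Y, T ⟶ Γ Y)
    (hσ : ∀ Y Z, Y ⊆ Z → σ Z ≫ transition Γ ι hfree Y Z = σ Y) :
    ∃! m : T ⟶ freeProalgebraicGroup X, ∀ Y : Finset X, m ≫ projection Γ ι Y = σ Y := by
  have hproj (f : T ⟶ freeProalgebraicGroup X) (Y : Finset X) :
      f ≫ projection Γ ι Y = σ Y ↔ f ≫ truncation Y = σ Y ≫ inclusion Γ ι hfree Y := by
    rw [← projection_comp_inclusion Γ ι hfree, ← Category.assoc]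
    refine ⟨fun h => congrArg (· ≫ inclusion Γ ι hfree Y) h, fun h => ?_⟩
    have h1 := congrArg (· ≫ projection Γ ι Y) h
    simpa only [Category.assoc, inclusion_comp_projection, transition_self, Category.comp_id]
      using h1
  simp only [hproj]
  refine existsUnique_comp_truncation _ fun Y Z hYZ => ?_
  rw [← hσ Y Z hYZ, ← projection_comp_inclusion Γ ι hfree, ← inclusion_comp_projection]
  simp only [Category.assoc]

/-- The free proalgebraic group on `X` is the limit of the system of the free proalgebraic groups
on the finite subsets. -/
def isLimitFreeCone : IsLimit (freeCone Γ ι hfree) :=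
  have h (s : Cone (freeSystem Γ ι hfree)) := existsUnique_comp_projection Γ ι hfree
    (fun Y => s.π.app (op Y)) fun _ _ hYZ => s.w (homOfLE hYZ).op
  { lift s := (h s).choose
    fac s Y := (h s).choose_spec.1 Y.unop
    uniq s m hm := (h s).choose_spec.2 m fun Y => hm (op Y) }

end System

end ProalgebraicGroup

theorem lemma3p1 (X : Type u) :
    -- free proalgebraic groups on the finite subsets of `X` exist
    (∀ Y : Finset X, ∃ (G : ProalgebraicGroup.{u}) (ι : Y → G.Points),
      ProalgebraicGroup.IsFreeOn ι) ∧
    -- for every choice of them,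
    ∀ (Γ : Finset X → ProalgebraicGroup.{u}) (ι : ∀ Y : Finset X, Y → (Γ Y).Points)
      (hfree : ∀ Y : Finset X, ProalgebraicGroup.IsFreeOn (ι Y)),
      -- the projective limit of the system exists,
      HasLimit (ProalgebraicGroup.freeSystem Γ ι hfree) ∧
      -- it is free on `X` via the canonical map from `X` to its `ℂ`-points,
      (∀ c : Cone (ProalgebraicGroup.freeSystem Γ ι hfree), IsLimit c →
        (∃! j : X → c.pt.Points, ProalgebraicGroup.IsCanonicalMap Γ ι hfree c j) ∧
        ∀ j : X → c.pt.Points, ProalgebraicGroup.IsCanonicalMap Γ ι hfree c j →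
          ProalgebraicGroup.IsFreeOn j) ∧
      -- and every free proalgebraic group on `X` is a projective limit of the system via
      -- the canonical projections.
      (∀ (c : Cone (ProalgebraicGroup.freeSystem Γ ι hfree)) (j : X → c.pt.Points),
        ProalgebraicGroup.IsCanonicalMap Γ ι hfree c j → ProalgebraicGroup.IsFreeOn j →
          Nonempty (IsLimit c)) := by
  open ProalgebraicGroup in
  refine ⟨fun Y => ⟨_, _, isFreeOn_generator⟩, fun Γ ι hfree => ⟨⟨⟨_, isLimitFreeCone Γ ι hfree⟩⟩,
    fun c hc => ?_, fun c j hj hjfree => ?_⟩⟩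
  -- Any limit is the explicit one up to a unique isomorphism, which carries the generators to the
  -- canonical map. The latter is unique because points of a limit are determined by their
  -- projections.
  · let e : freeProalgebraicGroup X ≅ c.pt :=
      (isLimitFreeCone Γ ι hfree).conePointUniqueUpToIso hc
    have he (Y : Finset X) : e.hom ≫ c.π.app (Opposite.op Y) = projection Γ ι Y :=
      (isLimitFreeCone Γ ι hfree).conePointUniqueUpToIso_hom_comp hc (Opposite.op Y)
    have hcan : IsCanonicalMap Γ ι hfree c fun x => mapPoints e.hom (generator x) := by
      intro Y x
      rw [← mapPoints_projection, ← he]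
      exact (mapPoints_comp e.hom _ _).symm
    have huniq (j : X → c.pt.Points) (hj : IsCanonicalMap Γ ι hfree c j) :
        j = fun x => mapPoints e.hom (generator x) :=
      funext fun x => points_ext_of_isLimit hc fun Y =>
        (hj Y.unop x).trans (hcan Y.unop x).symm
    refine ⟨⟨_, hcan, huniq⟩, fun j hj => ?_⟩
    rw [huniq j hj]
    exact isFreeOn_generator.map_iso e
  · obtain ⟨e, he⟩ := (isFreeOn_generator (X := X)).exists_iso hjfree
    -- The isomorphism of free objects is one of cones: the legs agree on generators, and their
    -- images converge to `1`.
    refine ⟨(isLimitFreeCone Γ ι hfree).ofIsoLimit (Cone.ext e fun Y => ?_)⟩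
    refine isFreeOn_generator.hom_ext (X := X) ?_ fun x => ?_
    · exact (funext (mapPoints_projection Γ ι Y.unop)) ▸ convergesToOne_extendByOne _ _
    · refine (mapPoints_projection Γ ι Y.unop x).trans ?_
      refine Eq.trans ?_ (mapPoints_comp e.hom _ _).symm
      rw [he]
      exact (hj Y.unop x).symm

end
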